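/- **Colour Refinement.** For a finite simple graph $G$ put $\chi^0_G(v)=$ a constant and $\chi^{i+1}_G(v)=\big(\chi^i_G(v),\{\!\{\chi^i_G(w) : w\in N(v)\}\!\}\big)$, and let $\pi^i_G$ be the partition of $V(G)$ into the classes of equal $\chi^i_G$-colour. Let $\mathrm{WL}_1(G)$ be the least $j$ with $\pi^j_G=\pi^{j+1}_G$. The graph $G$ is a *long-refinement graph* if $\mathrm{WL}_1(G)=|G|-1$. **Base graphs.** Let $\ell\ge 3$ and let $\Xi:\{1,\dots,\ell\}\to\{0,1,\mathrm S,\mathrm X\}$ be a string with $\mathrm S$ exactly in position $1$ and with exactly two positions $r<r'$ of letter $\mathrm X$. The base (multi)graph $G(\Xi)$ has vertices $v_{i,j}$ ($1\le i\le \ell$, $j\in\{1,2\}$) and the edges - $v_{i,j}v_{i+1,j}$ for $1\le i<\ell$, $j\in\{1,2\}$; - $v_{r,j}v_{1,1}$ and $v_{r',j}v_{1,2}$ for $j\in\{1,2\}$; - inside the pair $\{v_{i,1},v_{i,2}\}$: one edge if $\Xi(i)=1$, and one edge (one further edge, if $\Xi(\ell)=1$) if $i=\ell$. **Hat strings.**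 Let $\hat\Xi:\{1,\dots,\ell\}\to\{0,1,\mathrm S,\mathrm X,\hat 1,\hat{\mathrm X}\}$, and let $\Xi$ be its base string, obtained by replacing $\hat 1$ by $1$ and $\hat{\mathrm X}$ by $\mathrm X$. Then $\hat\Xi$ is a *hat string* if $\Xi$ is a string as above and $v_{i,1},v_{i,2}$ are adjacent in $G(\Xi)$ for every $i$ with $\hat\Xi(i)\in\{\hat1,\hat{\mathrm X}\}$. The graph $G(\hat\Xi)$ arises from $G(\Xi)$ by subdividing, for each such $i$, one edge between $v_{i,1}$ and $v_{i,2}$ with a new vertex (a *hat*), and identifying any remaining parallel edges. (So if $\hat\Xi(\ell)=\hat 1$, the last pair and its hat form a triangle.) **Theorem.** Every string $\hat\Xi$ in one of the following sets is a hat string, and $G(\hat\Xi)$ is a long-refinement graph of odd order whose set of vertex degrees is $\{2,3\}$. (Here $(w)^k$ is the $k$-fold concatenation of $w$, and $1^k=(1)^k$.) - $\{\mathrm{S}\hat 1 11\mathrm{XX}\}$ - $\{\mathrm{S0X1\hat X}\}\cup\{\mathrm S\,1^k\,101\,1^k\,\mathrm{X1X}\,1^k\,\hat 1 \mid k\ge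 0\}$ - $\{\mathrm{S110X\hat X}\}\cup\{\mathrm S\,11\,1^k\,101\,1^k\,\mathrm{XX}\,1^k\,\hat 1 \mid k\ge 0\}$ - $\{\mathrm S\,1^k\,0\,1^k\,1\,\mathrm{XX}\,1^k\,\hat 1 \mid k\ge 0\}$ - $\{\mathrm S\,(011)^k\,00\,(110)^k\,\mathrm X\hat 1\mathrm X\,(011)^k\,0 \mid k\ge 0\}$ -/

import Mathlib

namespace LongRefinement

section ColourRefinement

/-- The colours occurring after `i` iterations, if the initial colours come from `C`. -/
def Colour (C : Type*) : ℕ → Type _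
  | 0 => C
  | i + 1 => Colour C i × Multiset (Colour C i)

variable {V : Type*} [Fintype V] (G : SimpleGraph V) [DecidableRel G.Adj]

/-- The colouring `χ^i` computed by Colour Refinement after `i` iterations on `(G, lam)`. -/
def chi {C : Type*} (lam : V → C) : (i : ℕ) → V → Colour C i
  | 0, v => lam v
  | i + 1, v => (chi lam i v, (G.neighborFinset v).val.map (chi lam i))

/-- The partition (as an equivalence relation) of the vertex set into the colour classes
of `χ^i`. -/
def colourPartition {C : Type*} (lam : V → C) (i : ℕ) : Setoid V :=
  Setoid.ker (chi G lam i)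

/-- The iterations after which the partition does not change any more. -/
def stableIterations {C : Type*} (lam : V → C) : Set ℕ :=
  {j | colourPartition G lam j = colourPartition G lam (j + 1)}

/-- Colour Refinement stabilises on every finite coloured graph. -/
theorem stableIterations_nonempty {C : Type*} (lam : V → C) :
    (stableIterations G lam).Nonempty := by
  by_contra hne
  rw [Set.not_nonempty_iff_eq_empty] at hne
  have hlt : ∀ j, colourPartition G lam (j + 1) < colourPartition G lam j := by
    intro j
    refine lt_of_le_of_ne ?_ ?_
    · intro x y hxy
      exact congrArg Prod.fst (hxy : chi G lam (j + 1) x = chi G lam (j + 1) y)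
    · intro h
      have hj : j ∈ stableIterations G lam := h.symm
      rw [hne] at hj
      exact hj
  have hinj : Function.Injective (colourPartition G lam) :=
    (strictAnti_nat_of_succ_lt hlt).injective
  have hfin : Finite (Setoid V) :=
    Finite.of_injective (fun s : Setoid V => (s : V → V → Prop))
      (fun s t h => Setoid.ext fun a b => iff_of_eq (congrFun (congrFun h a) b))
  exact not_injective_infinite_finite _ hinj

/-- The number of iterations of Colour Refinement on the coloured graph `(G, lam)`: the minimal
`j` such that the partitions after `j` and after `j + 1` iterations agree. -/
noncomputable def iterationNumber {C : Type*} (lam : V → C) : ℕ :=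
  sInf (stableIterations G lam)

/-- The infimum in `iterationNumber` is attained. -/
theorem iterationNumber_isLeast {C : Type*} (lam : V → C) :
    IsLeast (stableIterations G lam) (iterationNumber G lam) :=
  ⟨Nat.sInf_mem (stableIterations_nonempty G lam), fun _ hj => Nat.sInf_le hj⟩

/-- A long-refinement graph: the (monochromatic) graph `G` needs `|G| - 1` iterations. -/
def IsLongRefinementGraph : Prop :=
  iterationNumber G (fun _ : V => ()) + 1 = Fintype.card V

end ColourRefinement

/-- The alphabet `{0, 1, S, X}`. -/
inductive Letter
  | zero | one | S | X
  deriving DecidableEq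

/-- The alphabet `{0, 1, S, X, 1̂, X̂}`. -/
inductive HatLetter
  | zero | one | S | X | oneHat | XHat
  deriving DecidableEq

/-- Removing the hat of a letter. -/
def HatLetter.base : HatLetter → Letter
  | .zero => .zero
  | .one => .one
  | .S => .S
  | .X => .X
  | .oneHat => .one
  | .XHat => .X

/-- Whether a letter carries a hat. -/
def HatLetter.isHat : HatLetter → Bool
  | .oneHat => true
  | .XHat => true
  | _ => false

section Base

variable {ℓ : ℕ}

/-- The strings to which a graph is assigned: length at least three, `S` exactly in the first
position, and exactly two letters `X`. -/
def IsBaseString (Xi : Fin ℓ → Letter) : Prop :=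
  3 ≤ ℓ ∧ (∀ i, Xi i = Letter.S ↔ i.val = 0) ∧
    ∃ r r', r < r' ∧ ∀ i, Xi i = Letter.X ↔ i = r ∨ i = r'

/-- `i` is the first one, `r`, of the two positions with letter `X`. -/
def IsFirstX (Xi : Fin ℓ → Letter) (i : Fin ℓ) : Prop :=
  Xi i = Letter.X ∧ ∃ k, i < k ∧ Xi k = Letter.X

/-- `i` is the second one, `r'`, of the two positions with letter `X`. -/
def IsSecondX (Xi : Fin ℓ → Letter) (i : Fin ℓ) : Prop :=
  Xi i = Letter.X ∧ ∃ k, k < i ∧ Xi k = Letter.X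

/-- The edges of the base graph between different pairs, each in one orientation. The vertex
`v_{i,j}` is `(i, j)`, with positions and indices counted from `0`. -/
def CrossEdge (Xi : Fin ℓ → Letter) (u v : Fin ℓ × Fin 2) : Prop :=
  (v.1.val = u.1.val + 1 ∧ v.2 = u.2) ∨
  (IsFirstX Xi u.1 ∧ v.1.val = 0 ∧ v.2 = 0) ∨
  (IsSecondX Xi u.1 ∧ v.1.val = 0 ∧ v.2 = 1)

/-- The number of parallel edges between the two vertices of the `i`-th pair: one if the letter
is `1`, and one more if the pair is the last one. With this, vertices of `0`-pairs have degree `2`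
and all other vertices have degree `3`, counting edges with multiplicity. -/
def innerEdges (Xi : Fin ℓ → Letter) (i : Fin ℓ) : ℕ :=
  (if Xi i = Letter.one then 1 else 0) + (if i.val + 1 = ℓ then 1 else 0)

/-- The simple graph underlying the base graph `G(Ξ)`. -/
def baseGraph (Xi : Fin ℓ → Letter) : SimpleGraph (Fin ℓ × Fin 2) :=
  SimpleGraph.fromRel fun u v =>
    CrossEdge Xi u v ∨ (u.1 = v.1 ∧ 0 < innerEdges Xi u.1)

end Base

section Hat

variable {ℓ : ℕ}

/-- The base string of a string over the alphabet with hats. -/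
def baseString (Xi : Fin ℓ → HatLetter) : Fin ℓ → Letter := fun i => (Xi i).base

/-- A hat string: every pair at a position with a hat is adjacent in the base graph. -/
def IsHatString (Xi : Fin ℓ → HatLetter) : Prop :=
  IsBaseString (baseString Xi) ∧
    ∀ i, (Xi i).isHat = true → (baseGraph (baseString Xi)).Adj (i, 0) (i, 1)

/-- The vertices `v_{i,j}` of the base graph, and one fresh vertex for every hat. -/
abbrev HatVertex (Xi : Fin ℓ → HatLetter) : Type :=
  (Fin ℓ × Fin 2) ⊕ {i : Fin ℓ // (Xi i).isHat = true}

/-- The edges (in one orientation) after one of the edges inside every hat pair has been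
subdivided by a hat. -/
def HatEdge (Xi : Fin ℓ → HatLetter) : HatVertex Xi → HatVertex Xi → Prop
  | Sum.inl u, Sum.inl v =>
      CrossEdge (baseString Xi) u v ∨
        (u.1 = v.1 ∧ (if (Xi u.1).isHat = true then 1 else 0) < innerEdges (baseString Xi) u.1)
  | Sum.inl u, Sum.inr h => u.1 = h.1
  | Sum.inr _, _ => False

/-- The graph `G(Ξ̂)`. -/
def hatGraph (Xi : Fin ℓ → HatLetter) : SimpleGraph (HatVertex Xi) :=
  SimpleGraph.fromRel (HatEdge Xi)

instance hatEdgeDecidable (Xi : Fin ℓ → HatLetter) : DecidableRel (HatEdge Xi)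
  | Sum.inl u, Sum.inl v => by
      unfold HatEdge CrossEdge IsFirstX IsSecondX; infer_instance
  | Sum.inl u, Sum.inr h => by unfold HatEdge; infer_instance
  | Sum.inr _, _ => by unfold HatEdge; infer_instance

instance hatGraphDecidable (Xi : Fin ℓ → HatLetter) : DecidableRel (hatGraph Xi).Adj := by
  unfold hatGraph; infer_instance

end Hat

section Families

/-- The `k`-fold concatenation `(w)^k`. -/
def rep (w : List HatLetter) (k : ℕ) : List HatLetter := (List.replicate k w).flatten

open HatLetter

/-- `S1̂11XX` -/
def family0 : Set (List HatLetter) := {[S, oneHat, one, one, X, X]}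

/-- `S0X1X̂` and `S 1^k 101 1^k X1X 1^k 1̂` -/
def family1 : Set (List HatLetter) :=
  {[S, zero, X, one, XHat]} ∪
  {w | ∃ k : ℕ, w = [S] ++ rep [one] k ++ [one, zero, one] ++ rep [one] k ++ [X, one, X]
    ++ rep [one] k ++ [oneHat]}

/-- `S110XX̂` and `S11 1^k 101 1^k XX 1^k 1̂` -/
def family2 : Set (List HatLetter) :=
  {[S, one, one, zero, X, XHat]} ∪
  {w | ∃ k : ℕ, w = [S, one, one] ++ rep [one] k ++ [one, zero, one] ++ rep [one] k ++ [X, X]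
    ++ rep [one] k ++ [oneHat]}

/-- `S 1^k 0 1^k 1XX 1^k 1̂` -/
def family3 : Set (List HatLetter) :=
  {w | ∃ k : ℕ, w = [S] ++ rep [one] k ++ [zero] ++ rep [one] k ++ [one, X, X]
    ++ rep [one] k ++ [oneHat]}

/-- `S (011)^k 00 (110)^k X1̂X (011)^k 0` -/
def family4 : Set (List HatLetter) :=
  {w | ∃ k : ℕ, w = [S] ++ rep [zero, one, one] k ++ [zero, zero] ++ rep [one, one, zero] k
    ++ [X, oneHat, X] ++ rep [zero, one, one] k ++ [zero]}

end Families

end LongRefinement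

/-! Contract every pair $\{v_{i,1},v_{i,2}\}$ to its position. The result is a multigraph on the
$\ell$ positions and the hat, except that $v_{1,1}$ sees the pair at $r$ and $v_{1,2}$ the pair at
$r'$; the contraction lists $r$ twice for both. This is harmless as long as $r$ and $r'$ have equal
colours, so up to that moment the colour of a vertex is the colour of its position, and no pair is
split (`mchi_comp`, `SingleHat.map_neighborFinset`).

For each string in the theorem, $r$ and $r'$ are separated on the contraction in iteration $\ell$
exactly. The next iteration splits the pair with letter S, and the split then travels along the two
parallel paths, one pair per iteration. The last pair is split in iteration $2\ell$. As the graph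
has $2\ell+1$ vertices, and at most $|G|-1$ iterations are ever possible, the bound is attained
(`SingleHat.isLongRefinementGraph`).

Both phases are instances of one principle, `mchi_wave`. Take a sequence of pairs of vertices whose
first pair is separated at a known time. Suppose that, while the later pairs are still identified,
the neighbourhoods of each pair agree up to a single colour, namely that of the preceding pair. Then
the pairs are separated one by one, in consecutive iterations. What is left for each family is to
exhibit such a sequence of length $\ell$ on the contraction, from two positions of different degree
to $(r,r')$. -/

namespace LongRefinement

/-! ### Colour Refinement on multigraphs and the wave principle -/

section Multigraph

variable {Q : Type*}

/-- Colour Refinement on a monochromatic multigraph, given by its multisets of neighbours. -/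
def mchi (nb : Q → Multiset Q) : (i : ℕ) → Q → Colour Unit i
  | 0, _ => ()
  | i + 1, v => (mchi nb i v, (nb v).map (mchi nb i))

theorem chi_eq_mchi {V : Type*} [Fintype V] (G : SimpleGraph V) [DecidableRel G.Adj] (i : ℕ) :
    chi G (fun _ : V => ()) i = mchi (fun v => (G.neighborFinset v).val) i := by
  induction i with
  | zero => rfl
  | succ i ih => funext v; simp only [chi, mchi, ih]; rfl

variable (nb : Q → Multiset Q)

theorem mchi_succ_inj {i : ℕ} {a b : Q} (h : mchi nb (i + 1) a = mchi nb (i + 1) b) :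
    mchi nb i a = mchi nb i b :=
  congrArg Prod.fst h

theorem mchi_mono {i j : ℕ} (hij : i ≤ j) {a b : Q} (h : mchi nb j a = mchi nb j b) :
    mchi nb i a = mchi nb i b := by
  induction j, hij using Nat.le_induction with
  | base => exact h
  | succ j _ ih => exact ih (mchi_succ_inj nb h)

/-- From a monochromatic start the older colour stored in `mchi` is redundant: the multiset of
neighbour colours in a round determines the multiset of the round before, by forgetting the last
refinement of each entry, and so by induction the vertex's own colour. -/
theorem mchi_succ_eq_iff {i : ℕ} {a b : Q} :
    mchi nb (i + 1) a = mchi nb (i + 1) b ↔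
      (nb a).map (mchi nb i) = (nb b).map (mchi nb i) := by
  refine ⟨fun h => congrArg Prod.snd h, fun h => Prod.ext ?_ h⟩
  change mchi nb i a = mchi nb i b
  induction i generalizing a b with
  | zero => rfl
  | succ i ih =>
    have h' : (nb a).map (mchi nb i) = (nb b).map (mchi nb i) := by
      have := congrArg (Multiset.map (fun c : Colour Unit (i + 1) => c.1)) h
      rw [Multiset.map_map, Multiset.map_map] at this
      exact this
    exact Prod.ext (ih h') h'

/-- A sequence of pairs of vertices which get separated one after the other: each pair is
distinguished by the previous one alone, as soon as the later pairs are identified. -/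
theorem mchi_wave (W n : ℕ) (x y : ℕ → Q)
    (heq : ∀ i ≤ n, mchi nb W (x i) = mchi nb W (y i))
    (hne : mchi nb (W + 1) (x 0) ≠ mchi nb (W + 1) (y 0))
    (hstep : ∀ i < n, ∀ t, (∀ k, i < k → k ≤ n → mchi nb t (x k) = mchi nb t (y k)) →
      ∃ s, (nb (x (i + 1))).map (mchi nb t) = mchi nb t (x i) ::ₘ s ∧
        (nb (y (i + 1))).map (mchi nb t) = mchi nb t (y i) ::ₘ s)
    (t i : ℕ) (hi : i ≤ n) : mchi nb t (x i) = mchi nb t (y i) ↔ t ≤ W + i := by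
  have lower : ∀ t i, i ≤ n → t ≤ W + i → mchi nb t (x i) = mchi nb t (y i) := by
    intro t
    induction t with
    | zero => intros; rfl
    | succ t ih =>
      intro i hi ht
      rcases Nat.lt_or_ge W (t + 1) with hW | hW
      · obtain ⟨j, rfl⟩ : ∃ j, i = j + 1 := ⟨i - 1, by omega⟩
        obtain ⟨s, h1, h2⟩ := hstep j (by omega) t fun k hk hkn => ih k hkn (by omega)
        rw [mchi_succ_eq_iff, h1, h2, ih j (by omega) (by omega)]
      · exact mchi_mono nb hW (heq i hi)
  refine ⟨fun h => ?_, lower t i hi⟩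
  by_contra! hlt
  have hsep : ∀ i ≤ n, mchi nb (W + i + 1) (x i) ≠ mchi nb (W + i + 1) (y i) := by
    intro i
    induction i with
    | zero => exact fun _ => hne
    | succ j ih =>
      intro hj heq'
      -- The upper bound needs the lower one: at time `W + (j + 1)` all later pairs are still
      -- identified, so the two neighbourhoods share `s` and can differ only in the colours of pair
      -- `j`, which are already distinct.
      obtain ⟨s, h1, h2⟩ := hstep j (by omega) (W + (j + 1)) fun k hk hkn =>
        lower _ k hkn (by omega)
      rw [mchi_succ_eq_iff, h1, h2, Multiset.cons_inj_left] at heq'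
      exact ih (by omega) heq'
  exact hsep i hi (mchi_mono nb hlt h)

/-- A map of multigraphs preserves colours as long as it preserves colours of neighbourhoods. -/
theorem mchi_comp {R : Type*} (nb' : R → Multiset R) (pr : Q → R) (T : ℕ)
    (h : ∀ t < T, ∀ v, (nb v).map (fun u => mchi nb' t (pr u)) = (nb' (pr v)).map (mchi nb' t)) :
    ∀ t ≤ T, ∀ v, mchi nb t v = mchi nb' t (pr v) := by
  intro t
  induction t with
  | zero => intros; rfl
  | succ t ih =>
    intro ht v
    have ih' := ih (by omega)
    refine Prod.ext (ih' v) ?_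
    change (nb v).map (mchi nb t) = _
    rw [show mchi nb t = fun u => mchi nb' t (pr u) from funext ih', h t (by omega) v]
    rfl

end Multigraph

/-! ### General bounds on the number of iterations -/

section Bounds

variable {V : Type*} [Fintype V] (G : SimpleGraph V) [DecidableRel G.Adj] {C : Type*} (lam : V → C)

theorem chi_mono {i j : ℕ} (hij : i ≤ j) {a b : V} (h : chi G lam j a = chi G lam j b) :
    chi G lam i a = chi G lam i b := by
  induction j, hij using Nat.le_induction with
  | base => exact h
  | succ j _ ih => exact ih (congrArg Prod.fst h)

/-- Every round before stabilisation splits some class, so the number of colours strictly grows from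
at least one. With at most `Fintype.card V` colours available, this yields the universal bound
$|G|-1$. -/
theorem card_range_chi_succ_le (j : ℕ) (hj : j ≤ iterationNumber G lam) [Nonempty V] :
    j + 1 ≤ Nat.card (Set.range (chi G lam j)) := by
  classical
  induction j with
  | zero => exact Nat.card_pos
  | succ j ih =>
    refine Nat.succ_le_of_lt (lt_of_le_of_lt (ih (by omega)) ?_)
    let F : Set.range (chi G lam (j + 1)) → Set.range (chi G lam j) :=
      fun c => ⟨c.1.1, by obtain ⟨_, v, rfl⟩ := c; exact ⟨v, rfl⟩⟩
    have hsurj : Function.Surjective F := by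
      rintro ⟨_, v, rfl⟩
      exact ⟨⟨_, v, rfl⟩, rfl⟩
    have : Fintype (Set.range (chi G lam j)) := Fintype.ofFinite _
    have : Fintype (Set.range (chi G lam (j + 1))) := Fintype.ofFinite _
    rw [Nat.card_eq_fintype_card, Nat.card_eq_fintype_card]
    -- If forgetting the last round lost no colour, the partition would already be stable at `j`,
    -- against minimality of the iteration number.
    refine Fintype.card_lt_of_surjective_not_injective F hsurj fun hinj => ?_
    have hmem : j ∈ stableIterations G lam := by
      refine Setoid.ext fun a b => ⟨fun hab => ?_, fun hab => chi_mono G lam (Nat.le_succ j) hab⟩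
      have := @hinj ⟨_, a, rfl⟩ ⟨_, b, rfl⟩ (Subtype.ext hab)
      exact congrArg Subtype.val this
    have := (iterationNumber_isLeast G lam).2 hmem
    omega

theorem iterationNumber_succ_le_card [Nonempty V] :
    iterationNumber G lam + 1 ≤ Fintype.card V := by
  refine (card_range_chi_succ_le G lam _ le_rfl).trans ?_
  rw [← Nat.card_eq_fintype_card]
  exact Finite.card_range_le _

/-- While the partitions at `j` and `i` coincide, colours at `i` are a function `g` of colours at
`j`. Applying `g` to the equal neighbour multisets of round `j` gives equal ones in round `i`, so
nothing splits in round `i + 1` either. -/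
theorem colourPartition_eq_of_stable {j i : ℕ} (h : j ∈ stableIterations G lam) (hij : j ≤ i) :
    colourPartition G lam i = colourPartition G lam j := by
  induction i, hij using Nat.le_induction with
  | base => rfl
  | succ i _ ih =>
    have step : colourPartition G lam j = colourPartition G lam (j + 1) := h
    refine Setoid.ext fun a b => ⟨fun hab => ?_, fun hab => ?_⟩
    · rw [← ih]
      exact chi_mono G lam (Nat.le_succ i) hab
    · have hab' : chi G lam i a = chi G lam i b := by
        have : colourPartition G lam i a b := by rw [ih]; exact hab
        exact this
      refine Prod.ext hab' ?_
      have hj : chi G lam (j + 1) a = chi G lam (j + 1) b := by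
        have : colourPartition G lam (j + 1) a b := by rw [← step]; exact hab
        exact this
      have hfac : ∃ g : Colour C j → Colour C i, ∀ v, chi G lam i v = g (chi G lam j v) := by
        have hsub : ∀ v w, chi G lam j v = chi G lam j w → chi G lam i v = chi G lam i w := by
          intro v w hvw
          have : colourPartition G lam i v w := by rw [ih]; exact hvw
          exact this
        have : Nonempty (Colour C i) := ⟨chi G lam i a⟩
        exact (Function.factorsThrough_iff _).1 (fun v w => hsub v w) |>.imp
          fun g hg v => congrFun hg v
      obtain ⟨g, hg⟩ := hfac
      change (G.neighborFinset a).val.map (chi G lam i) = (G.neighborFinset b).val.map (chi G lam i)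
      have hm := congrArg (Multiset.map g) (congrArg Prod.snd hj)
      change Multiset.map g ((G.neighborFinset a).val.map (chi G lam j)) =
        Multiset.map g ((G.neighborFinset b).val.map (chi G lam j)) at hm
      rw [Multiset.map_map, Multiset.map_map] at hm
      rw [show chi G lam i = g ∘ chi G lam j from funext hg]
      exact hm

/-- Two vertices that are separated late bound the number of iterations from below. -/
theorem le_iterationNumber_of_separated {a b : V} {T : ℕ}
    (h : ∀ t, chi G lam t a = chi G lam t b ↔ t < T) : T ≤ iterationNumber G lam := by
  by_contra! hlt
  have h1 : colourPartition G lam (iterationNumber G lam) a b := (h _).2 hlt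
  rw [← colourPartition_eq_of_stable G lam (iterationNumber_isLeast G lam).1 hlt.le] at h1
  exact lt_irrefl _ ((h T).1 h1)

end Bounds

/-! ### Separation times on the contraction: strings with a single letter 0 and a final hat -/

section Waves

variable {κ : Type*} {nb : ℕ → Multiset ℕ} {f : ℕ → κ}

/-- Supplies the step hypothesis of `mchi_wave` for vertices of degree two. The entries `p`, `p'`
need not be the preceding pair `P`, `P'` itself; having its colours is enough, which lets later,
still valid identifications be used. `cons_step_three` is the analogue for degree three. -/
theorem cons_step_two {X Y u v u' v' : ℕ} (hX : nb X = {u, v}) (hY : nb Y = {u', v'})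
    (p a p' a' : ℕ) {P P' : ℕ} (h : u = p ∧ v = a ∨ u = a ∧ v = p)
    (h' : u' = p' ∧ v' = a' ∨ u' = a' ∧ v' = p')
    (hp : f p = f P) (hp' : f p' = f P') (ha : f a = f a') :
    ∃ s, (nb X).map f = f P ::ₘ s ∧ (nb Y).map f = f P' ::ₘ s := by
  have e : nb X = {p, a} := by
    rw [hX]; rcases h with ⟨rfl, rfl⟩ | ⟨rfl, rfl⟩
    · rfl
    · exact Multiset.pair_comm _ _
  have e' : nb Y = {p', a'} := by
    rw [hY]; rcases h' with ⟨rfl, rfl⟩ | ⟨rfl, rfl⟩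
    · rfl
    · exact Multiset.pair_comm _ _
  exact ⟨{f a}, by rw [e, ← hp]; rfl, by rw [e', ← hp', ha]; rfl⟩

theorem triple_eq_of_perm {u v w p a b : ℕ}
    (h : u = p ∧ (v = a ∧ w = b ∨ v = b ∧ w = a) ∨ v = p ∧ (u = a ∧ w = b ∨ u = b ∧ w = a) ∨
      w = p ∧ (u = a ∧ v = b ∨ u = b ∧ v = a)) :
    ({u, v, w} : Multiset ℕ) = {p, a, b} := by
  change ((([u, v, w] : List ℕ)) : Multiset ℕ) = (([p, a, b] : List ℕ) : Multiset ℕ)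
  rw [Multiset.coe_eq_coe]
  grind

theorem cons_step_three {X Y u v w u' v' w' : ℕ} (hX : nb X = {u, v, w})
    (hY : nb Y = {u', v', w'}) (p a b p' a' b' : ℕ) {P P' : ℕ}
    (h : u = p ∧ (v = a ∧ w = b ∨ v = b ∧ w = a) ∨ v = p ∧ (u = a ∧ w = b ∨ u = b ∧ w = a) ∨
      w = p ∧ (u = a ∧ v = b ∨ u = b ∧ v = a))
    (h' : u' = p' ∧ (v' = a' ∧ w' = b' ∨ v' = b' ∧ w' = a') ∨
      v' = p' ∧ (u' = a' ∧ w' = b' ∨ u' = b' ∧ w' = a') ∨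
      w' = p' ∧ (u' = a' ∧ v' = b' ∨ u' = b' ∧ v' = a'))
    (hp : f p = f P) (hp' : f p' = f P') (ha : f a = f a') (hb : f b = f b') :
    ∃ s, (nb X).map f = f P ::ₘ s ∧ (nb Y).map f = f P' ::ₘ s := by
  rw [hX, hY, triple_eq_of_perm h, triple_eq_of_perm h']
  exact ⟨{f a, f b}, by rw [← hp]; rfl, by rw [← hp', ha, hb]; rfl⟩

theorem mchi_one_ne {x y : ℕ} (h : (nb x).card ≠ (nb y).card) :
    mchi nb 1 x ≠ mchi nb 1 y := fun h' => h <| by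
  have := congrArg Multiset.card ((mchi_succ_eq_iff nb).1 h')
  rwa [Multiset.card_map, Multiset.card_map] at this

/-- The 0-pair is at `m` and the hat at `3 * m + 2`. The wave starts at $(m,m+1)$, which differ in
degree, and has three phases: consecutive positions $(a,a+1)$ up to $(2m,2m+1)$; then, jumping
through the edge from $2m$ to $0$, the reflection about $m$, from $(0,2m)$ to $(m-1,m+1)$; finally
the reflection about $2m+1$, from the two degree-two vertices $(m,3m+2)$ to $(2m,2m+2)$. That makes
$3m+2$ pairs, the last one being $(r,r')$. -/
theorem separation_family1 (m : ℕ) (hm : 2 ≤ m) (h0 : nb 0 = {1, 2 * m, 2 * m})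
    (hz : nb m = {m - 1, m + 1})
    (hone : ∀ i, 1 ≤ i → i ≤ 3 * m + 1 → i ≠ m → i ≠ 2 * m → i ≠ 2 * m + 2 →
      nb i = {i - 1, i + 1, i})
    (hr : nb (2 * m) = {2 * m - 1, 2 * m + 1, 0})
    (hr' : nb (2 * m + 2) = {2 * m + 1, 2 * m + 3, 0})
    (hh : nb (3 * m + 2) = {3 * m + 1, 3 * m + 1}) (t : ℕ) :
    mchi nb t (2 * m) = mchi nb t (2 * m + 2) ↔ t < 3 * m + 2 := by
  obtain ⟨x, hx1, hx2⟩ : ∃ x : ℕ → ℕ, (∀ i ≤ m, x i = m + i) ∧ ∀ i, m < i → x i = i - m - 1 :=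
    ⟨fun i => if i ≤ m then m + i else i - m - 1, by grind, by grind⟩
  obtain ⟨y, hy1, hy2, hy3⟩ : ∃ y : ℕ → ℕ, (∀ i ≤ m, y i = m + i + 1) ∧
      (∀ i, m < i → i < 2 * m + 1 → y i = 3 * m + 1 - i) ∧
      (∀ i, 2 * m + 1 ≤ i → y i = 5 * m + 3 - i) :=
    ⟨fun i => if i ≤ m then m + i + 1 else if i < 2 * m + 1 then 3 * m + 1 - i else 5 * m + 3 - i,
      by grind, by grind, by grind⟩
  have key := mchi_wave nb 0 (3 * m + 1) x y (fun _ _ => rfl) ?_ ?_ t (3 * m + 1) le_rfl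
  · rw [hx2 _ (by omega), hy3 _ (by omega), show 3 * m + 1 - m - 1 = 2 * m by omega,
      show 5 * m + 3 - (3 * m + 1) = 2 * m + 2 by omega] at key
    rw [key]; omega
  · rw [hx1 0 (by omega), hy1 0 (by omega)]
    refine mchi_one_ne ?_
    simp [hz, hone (m + 1) (by omega) (by omega) (by omega) (by omega) (by omega)]
  intro i hi t H
  generalize mchi nb t = f at H ⊢
  -- `H1`, `H2`, `H3` restate, phase by phase, that the pairs after `i` are still identified. The
  -- inequality involving `i` says that the pair comes later in the wave; the fixed point of a
  -- reflection costs nothing.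
  have H1 : ∀ a b, b = a + 1 → i + m < a → a ≤ 2 * m → f a = f b := fun a b hb h1 h2 => by
    have := H (a - m) (by omega) (by omega)
    rw [hx1 _ (by omega), hy1 _ (by omega)] at this
    convert this using 2 <;> omega
  have H2 : ∀ a b, a + b = 2 * m → a ≤ m → i ≤ m + a → f a = f b := fun a b hb h1 h2 => by
    rcases h1.eq_or_lt with h | h
    · congr 1; omega
    have := H (a + m + 1) (by omega) (by omega)
    rw [hx2 _ (by omega), hy2 _ (by omega) (by omega)] at this
    convert this using 2 <;> omega
  have H3 : ∀ a b, a + b = 4 * m + 2 → m ≤ a → a ≤ 2 * m → i ≤ m + a → f a = f b :=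
    fun a b hb h1 h2 h3 => by
      have := H (a + m + 1) (by omega) (by omega)
      rw [hx2 _ (by omega), hy3 _ (by omega)] at this
      convert this using 2 <;> omega
  rcases Nat.lt_or_ge (i + 2) m with c | c
  · have e1 := hx1 i (by omega)
    have e2 := hx1 (i + 1) (by omega)
    have e3 := hy1 i (by omega)
    have e4 := hy1 (i + 1) (by omega)
    exact cons_step_three (hone _ (by omega) (by omega) (by omega) (by omega) (by omega))
      (hone _ (by omega) (by omega) (by omega) (by omega) (by omega))
      (m + i) (m + i + 1) (m + i + 2) (m + i + 1) (m + i + 2) (m + i + 3)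
      (by omega) (by omega) (by rw [e1]) (by rw [e3]) (H1 _ _ rfl (by omega) (by omega))
      (H1 _ _ rfl (by omega) (by omega))
  rcases Nat.lt_or_ge (i + 1) m with c0 | c0
  · have e1 := hx1 i (by omega)
    have e2 := hx1 (i + 1) (by omega)
    have e3 := hy1 i (by omega)
    rw [hy1 (i + 1) (by omega), show m + (i + 1) + 1 = 2 * m by omega]
    refine cons_step_three (hone _ (by omega) (by omega) (by omega) (by omega) (by omega)) hr
      (2 * m - 2) (2 * m) (2 * m - 1) (2 * m - 1) (2 * m + 1) 0
      (by omega) (by omega) (by congr 1; omega) (by congr 1; omega)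
      (H1 _ _ rfl (by omega) (by omega)) ?_
    exact (H1 _ (2 * m) (by omega) (by omega) (by omega)).trans
      (H2 0 (2 * m) (by omega) (by omega) (by omega)).symm
  rcases Nat.lt_or_ge i m with c1 | c1
  · have e1 := hx1 i (by omega)
    have e3 := hy1 i (by omega)
    rw [hx1 (i + 1) (by omega), hy1 (i + 1) (by omega), show m + (i + 1) = 2 * m by omega]
    refine cons_step_three hr (hone _ (by omega) (by omega) (by omega) (by omega) (by omega))
      (2 * m - 1) (2 * m + 1) 0 (2 * m) (2 * m + 1) (2 * m + 2)
      (by omega) (by omega) (by congr 1; omega) (by congr 1; omega) rfl ?_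
    exact (H2 0 (2 * m) (by omega) (by omega) (by omega)).trans
      (H3 _ _ (by omega) (by omega) (by omega) (by omega))
  rcases Nat.lt_or_ge i (m + 1) with c2 | c2
  · have e1 := hx1 i (by omega)
    have e3 := hy1 i (by omega)
    rw [hx2 (i + 1) (by omega), hy2 (i + 1) (by omega) (by omega),
      show i + 1 - m - 1 = 0 by omega, show 3 * m + 1 - (i + 1) = 2 * m by omega]
    exact cons_step_three h0 hr (2 * m) 1 (2 * m) (2 * m + 1) (2 * m - 1) 0
      (by omega) (by omega) (by congr 1; omega) (by congr 1; omega)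
      (H2 _ _ (by omega) (by omega) (by omega)) (H2 0 (2 * m) (by omega) (by omega) (by omega)).symm
  have e1 := hx2 i (by omega)
  have e2 := hx2 (i + 1) (by omega)
  rcases Nat.lt_or_ge (i + 1) (2 * m + 1) with c3 | c3
  · have e3 := hy2 i (by omega) (by omega)
    have e4 := hy2 (i + 1) (by omega) (by omega)
    exact cons_step_three (hone _ (by omega) (by omega) (by omega) (by omega) (by omega))
      (hone _ (by omega) (by omega) (by omega) (by omega) (by omega))
      (x i) (x (i + 1)) (x (i + 1) + 1) (y i) (y (i + 1)) (y (i + 1) - 1)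
      (by omega) (by omega) rfl rfl (H2 _ _ (by omega) (by omega) (by omega))
      (H2 _ _ (by omega) (by omega) (by omega))
  rcases Nat.lt_or_ge i (2 * m + 1) with c4 | c4
  · have e3 := hy2 i (by omega) (by omega)
    rw [hy3 (i + 1) (by omega), show x (i + 1) = m by omega,
      show 5 * m + 3 - (i + 1) = 3 * m + 2 by omega]
    -- Turning from the second phase to the third: the two neighbours of the 0-pair have just been
    -- separated from each other, whereas the hat sees one position twice, and that position still
    -- has the colour of `m + 1`.
    exact cons_step_two hz hh (m - 1) (m + 1) (3 * m + 1) (3 * m + 1)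
      (by omega) (by omega) (by congr 1; omega)
      ((H3 (m + 1) _ (by omega) (by omega) (by omega) (by omega)).symm.trans (by congr 1; omega))
      (H3 _ _ (by omega) (by omega) (by omega) (by omega))
  have e3 := hy3 i (by omega)
  have e4 := hy3 (i + 1) (by omega)
  rcases Nat.lt_or_ge (i + 1) (3 * m + 1) with c5 | c5
  · exact cons_step_three (hone _ (by omega) (by omega) (by omega) (by omega) (by omega))
      (hone _ (by omega) (by omega) (by omega) (by omega) (by omega))
      (x i) (x (i + 1)) (x (i + 1) + 1) (y i) (y (i + 1)) (y (i + 1) - 1)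
      (by omega) (by omega) rfl rfl (H3 _ _ (by omega) (by omega) (by omega) (by omega))
      (H3 _ _ (by omega) (by omega) (by omega) (by omega))
  · rw [show x (i + 1) = 2 * m by omega, show y (i + 1) = 2 * m + 2 by omega]
    exact cons_step_three hr hr' (2 * m - 1) (2 * m + 1) 0 (2 * m + 3) (2 * m + 1) 0
      (by omega) (by omega) (by congr 1; omega) (by congr 1; omega) rfl rfl


/-- Again three phases from the 0-pair at `m`: consecutive positions up to $(2m+1,2m)$, the
reflection $a+b=2m$ starting at $(0,2m)$, and the reflection $a+b=4m+3$ from $(m,3m+3)$ to the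
adjacent X-pairs. The first phase lists the larger position first, since it is $2m+1$, not $2m$,
that is joined to $0$. -/
theorem separation_family3 (m : ℕ) (hm : 1 ≤ m) (h0 : nb 0 = {1, 2 * m + 1, 2 * m + 1})
    (hz : nb m = {m - 1, m + 1})
    (hone : ∀ i, 1 ≤ i → i ≤ 3 * m + 2 → i ≠ m → i ≠ 2 * m + 1 → i ≠ 2 * m + 2 →
      nb i = {i - 1, i + 1, i})
    (hr : nb (2 * m + 1) = {2 * m, 2 * m + 2, 0})
    (hr' : nb (2 * m + 2) = {2 * m + 1, 2 * m + 3, 0})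
    (hh : nb (3 * m + 3) = {3 * m + 2, 3 * m + 2}) (t : ℕ) :
    mchi nb t (2 * m + 1) = mchi nb t (2 * m + 2) ↔ t < 3 * m + 3 := by
  obtain ⟨x, hx1, hx2⟩ : ∃ x : ℕ → ℕ, (∀ i ≤ m, x i = m + i + 1) ∧
      ∀ i, m < i → x i = i - m - 1 :=
    ⟨fun i => if i ≤ m then m + i + 1 else i - m - 1, by grind, by grind⟩
  obtain ⟨y, hy1, hy2, hy3⟩ : ∃ y : ℕ → ℕ, (∀ i ≤ m, y i = m + i) ∧
      (∀ i, m < i → i < 2 * m + 1 → y i = 3 * m + 1 - i) ∧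
      (∀ i, 2 * m + 1 ≤ i → y i = 5 * m + 4 - i) :=
    ⟨fun i => if i ≤ m then m + i else if i < 2 * m + 1 then 3 * m + 1 - i else 5 * m + 4 - i,
      by grind, by grind, by grind⟩
  have key := mchi_wave nb 0 (3 * m + 2) x y (fun _ _ => rfl) ?_ ?_ t (3 * m + 2) le_rfl
  · rw [hx2 _ (by omega), hy3 _ (by omega), show 3 * m + 2 - m - 1 = 2 * m + 1 by omega,
      show 5 * m + 4 - (3 * m + 2) = 2 * m + 2 by omega] at key
    rw [key]; omega
  · rw [hx1 0 (by omega), hy1 0 (by omega)]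
    refine mchi_one_ne ?_
    simp [hz, hone (m + 1) (by omega) (by omega) (by omega) (by omega) (by omega)]
  intro i hi t H
  generalize mchi nb t = f at H ⊢
  have H1 : ∀ a b, b = a + 1 → i + m < a → a ≤ 2 * m → f a = f b := fun a b hb h1 h2 => by
    have := H (a - m) (by omega) (by omega)
    rw [hx1 _ (by omega), hy1 _ (by omega)] at this
    convert this.symm using 2 <;> omega
  have H2 : ∀ a b, a + b = 2 * m → a ≤ m → i ≤ m + a → f a = f b := fun a b hb h1 h2 => by
    rcases h1.eq_or_lt with h | h
    · congr 1; omega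
    have := H (a + m + 1) (by omega) (by omega)
    rw [hx2 _ (by omega), hy2 _ (by omega) (by omega)] at this
    convert this using 2 <;> omega
  have H3 : ∀ a b, a + b = 4 * m + 3 → m ≤ a → a ≤ 2 * m + 1 → i ≤ m + a → f a = f b :=
    fun a b hb h1 h2 h3 => by
      have := H (a + m + 1) (by omega) (by omega)
      rw [hx2 _ (by omega), hy3 _ (by omega)] at this
      convert this using 2 <;> omega
  rcases Nat.lt_or_ge (i + 1) m with c | c
  · have e1 := hx1 i (by omega)
    have e2 := hx1 (i + 1) (by omega)
    have e3 := hy1 i (by omega)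
    have e4 := hy1 (i + 1) (by omega)
    exact cons_step_three (hone _ (by omega) (by omega) (by omega) (by omega) (by omega))
      (hone _ (by omega) (by omega) (by omega) (by omega) (by omega))
      (m + i + 1) (m + i + 3) (m + i + 2) (m + i) (m + i + 2) (m + i + 1)
      (by omega) (by omega) (by rw [e1]) (by rw [e3]) (H1 _ _ rfl (by omega) (by omega)).symm
      (H1 _ _ rfl (by omega) (by omega)).symm
  rcases Nat.lt_or_ge i m with c1 | c1
  · have e1 := hx1 i (by omega)
    have e3 := hy1 i (by omega)
    rw [hx1 (i + 1) (by omega), hy1 (i + 1) (by omega), show m + (i + 1) = 2 * m by omega]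
    exact cons_step_three hr (hone _ (by omega) (by omega) (by omega) (by omega) (by omega))
      (2 * m) (2 * m + 2) 0 (2 * m - 1) (2 * m + 1) (2 * m)
      (by omega) (by omega) (by congr 1; omega) (by congr 1; omega)
      (H3 _ _ (by omega) (by omega) (by omega) (by omega)).symm
      (H2 _ _ (by omega) (by omega) (by omega))
  rcases Nat.lt_or_ge i (m + 1) with c2 | c2
  · have e1 := hx1 i (by omega)
    have e3 := hy1 i (by omega)
    rw [hx2 (i + 1) (by omega), show i + 1 - m - 1 = 0 by omega]
    have e4 : y (i + 1) = 2 * m := by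
      rw [hy2 (i + 1) (by omega) (by omega)]; omega
    rw [e4]
    exact cons_step_three h0
      (hone (2 * m) (by omega) (by omega) (by omega) (by omega) (by omega))
      (2 * m + 1) 1 (2 * m + 1) (2 * m) (2 * m - 1) (2 * m + 1)
      (by omega) (by omega) (by congr 1; omega) (by congr 1; omega)
      (H2 _ _ (by omega) (by omega) (by omega)) rfl
  have e1 := hx2 i (by omega)
  have e2 := hx2 (i + 1) (by omega)
  rcases Nat.lt_or_ge (i + 1) (2 * m + 1) with c3 | c3
  · have e3 := hy2 i (by omega) (by omega)
    have e4 := hy2 (i + 1) (by omega) (by omega)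
    exact cons_step_three (hone _ (by omega) (by omega) (by omega) (by omega) (by omega))
      (hone _ (by omega) (by omega) (by omega) (by omega) (by omega))
      (x i) (x (i + 1)) (x (i + 1) + 1) (y i) (y (i + 1)) (y (i + 1) - 1)
      (by omega) (by omega) rfl rfl (H2 _ _ (by omega) (by omega) (by omega))
      (H2 _ _ (by omega) (by omega) (by omega))
  rcases Nat.lt_or_ge i (2 * m + 1) with c4 | c4
  · have e3 := hy2 i (by omega) (by omega)
    rw [hy3 (i + 1) (by omega), show x (i + 1) = m by omega,
      show 5 * m + 4 - (i + 1) = 3 * m + 3 by omega]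
    exact cons_step_two hz hh (m - 1) (m + 1) (3 * m + 2) (3 * m + 2)
      (by omega) (by omega) (by congr 1; omega)
      ((H3 (m + 1) _ (by omega) (by omega) (by omega) (by omega)).symm.trans (by congr 1; omega))
      (H3 _ _ (by omega) (by omega) (by omega) (by omega))
  have e3 := hy3 i (by omega)
  have e4 := hy3 (i + 1) (by omega)
  rcases Nat.lt_or_ge (i + 1) (3 * m + 2) with c5 | c5
  · exact cons_step_three (hone _ (by omega) (by omega) (by omega) (by omega) (by omega))
      (hone _ (by omega) (by omega) (by omega) (by omega) (by omega))
      (x i) (x (i + 1)) (x (i + 1) + 1) (y i) (y (i + 1)) (y (i + 1) - 1)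
      (by omega) (by omega) rfl rfl (H3 _ _ (by omega) (by omega) (by omega) (by omega))
      (H3 _ _ (by omega) (by omega) (by omega) (by omega))
  · rw [show x (i + 1) = 2 * m + 1 by omega, show y (i + 1) = 2 * m + 2 by omega]
    exact cons_step_three hr hr' (2 * m) (2 * m + 2) 0 (2 * m + 3) (2 * m + 1) 0
      (by omega) (by omega) (by congr 1; omega) (by congr 1; omega)
      (H3 _ _ (by omega) (by omega) (by omega) (by omega)).symm rfl

/-- The 0-pair is at `m + 2`. After consecutive positions up to $(2m+2,2m+1)$ the wave makes a
detour through $(1,2m+2)$ and $(1,0)$, visiting position $1$ twice, before the reflection $a+b=2m+4$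
from $(2,2m+2)$ and the reflection $a+b=4m+5$ from $(m+2,3m+3)$ to $(r,r')$. -/
theorem separation_family2 (m : ℕ) (hm : 2 ≤ m) (h0 : nb 0 = {1, 2 * m + 2, 2 * m + 2})
    (hz : nb (m + 2) = {m + 1, m + 3})
    (hone : ∀ i, 1 ≤ i → i ≤ 3 * m + 2 → i ≠ m + 2 → i ≠ 2 * m + 2 → i ≠ 2 * m + 3 →
      nb i = {i - 1, i + 1, i})
    (hr : nb (2 * m + 2) = {2 * m + 1, 2 * m + 3, 0})
    (hr' : nb (2 * m + 3) = {2 * m + 2, 2 * m + 4, 0})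
    (hh : nb (3 * m + 3) = {3 * m + 2, 3 * m + 2}) (t : ℕ) :
    mchi nb t (2 * m + 2) = mchi nb t (2 * m + 3) ↔ t < 3 * m + 3 := by
  obtain ⟨x, hx1, hx2⟩ : ∃ x : ℕ → ℕ, (∀ i < m, x i = m + i + 3) ∧
      ∀ i, m ≤ i → x i = if i = m then 1 else i - m :=
    ⟨fun i => if i < m then m + i + 3 else if i = m then 1 else i - m, by grind, by grind⟩
  obtain ⟨y, hy1, hy0, hy2, hy3⟩ : ∃ y : ℕ → ℕ, (∀ i ≤ m, y i = m + i + 2) ∧ y (m + 1) = 0 ∧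
      (∀ i, m + 1 < i → i < 2 * m + 2 → y i = 3 * m + 4 - i) ∧
      (∀ i, 2 * m + 2 ≤ i → y i = 5 * m + 5 - i) :=
    ⟨fun i => if i ≤ m then m + i + 2 else if i = m + 1 then 0 else
      if i < 2 * m + 2 then 3 * m + 4 - i else 5 * m + 5 - i,
      by grind, by grind, by grind, by grind⟩
  have hxm : x m = 1 := by rw [hx2 m le_rfl, if_pos rfl]
  replace hx2 : ∀ i, m < i → x i = i - m := fun i h => by rw [hx2 i h.le, if_neg (by omega)]
  have key := mchi_wave nb 0 (3 * m + 2) x y (fun _ _ => rfl) ?_ ?_ t (3 * m + 2) le_rfl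
  · rw [hx2 _ (by omega), hy3 _ (by omega), show 3 * m + 2 - m = 2 * m + 2 by omega,
      show 5 * m + 5 - (3 * m + 2) = 2 * m + 3 by omega] at key
    rw [key]; omega
  · rw [hx1 0 (by omega), hy1 0 (by omega)]
    refine mchi_one_ne ?_
    simp [hz, hone (m + 3) (by omega) (by omega) (by omega) (by omega) (by omega)]
  intro i hi t H
  generalize mchi nb t = f at H ⊢
  have H1 : ∀ a b, b = a + 1 → i + m + 2 < a → a ≤ 2 * m + 1 → f a = f b :=
    fun a b hb h1 h2 => by
      have := H (a - m - 2) (by omega) (by omega)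
      rw [hx1 _ (by omega), hy1 _ (by omega)] at this
      convert this.symm using 2 <;> omega
  have Hm : i < m → f 1 = f (2 * m + 2) := fun h => by
    have := H m (by omega) (by omega)
    rw [hxm, hy1 _ (by omega)] at this
    convert this using 2; omega
  have H0 : i < m + 1 → f 1 = f 0 := fun h => by
    have := H (m + 1) (by omega) (by omega)
    rw [hx2 _ (by omega), hy0] at this
    convert this using 2; omega
  have H2 : ∀ a b, a + b = 2 * m + 4 → 2 ≤ a → a ≤ m + 2 → i < m + a → f a = f b :=
    fun a b hb h0 h1 h2 => by
      rcases h1.eq_or_lt with h | h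
      · congr 1; omega
      have := H (a + m) (by omega) (by omega)
      rw [hx2 _ (by omega), hy2 _ (by omega) (by omega)] at this
      convert this using 2 <;> omega
  have H3 : ∀ a b, a + b = 4 * m + 5 → m + 2 ≤ a → a ≤ 2 * m + 2 → i < m + a → f a = f b :=
    fun a b hb h1 h2 h3 => by
      have := H (a + m) (by omega) (by omega)
      rw [hx2 _ (by omega), hy3 _ (by omega)] at this
      convert this using 2 <;> omega
  rcases Nat.lt_or_ge (i + 2) m with c | c
  · have e1 := hx1 i (by omega)
    have e2 := hx1 (i + 1) (by omega)
    have e3 := hy1 i (by omega)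
    have e4 := hy1 (i + 1) (by omega)
    exact cons_step_three (hone _ (by omega) (by omega) (by omega) (by omega) (by omega))
      (hone _ (by omega) (by omega) (by omega) (by omega) (by omega))
      (m + i + 3) (m + i + 5) (m + i + 4) (m + i + 2) (m + i + 4) (m + i + 3)
      (by omega) (by omega) (by congr 1; omega) (by congr 1; omega)
      (H1 _ _ rfl (by omega) (by omega)).symm
      (H1 _ _ rfl (by omega) (by omega)).symm
  rcases Nat.lt_or_ge (i + 1) m with c1 | c1
  · have e1 := hx1 i (by omega)
    have e3 := hy1 i (by omega)
    have e4 := hy1 (i + 1) (by omega)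
    rw [show x (i + 1) = 2 * m + 2 by rw [hx1 _ (by omega)]; omega]
    exact cons_step_three hr (hone _ (by omega) (by omega) (by omega) (by omega) (by omega))
      (2 * m + 1) (2 * m + 3) 0 (2 * m) (2 * m + 2) (2 * m + 1)
      (by omega) (by omega) (by congr 1; omega) (by congr 1; omega)
      (H3 _ _ (by omega) (by omega) (by omega) (by omega)).symm
      (((H0 (by omega)).symm.trans (Hm (by omega))).trans
        (H1 _ _ (by omega) (by omega) (by omega)).symm)
  rcases Nat.lt_or_ge i m with c2 | c2
  · have e1 := hx1 i (by omega)
    have e3 := hy1 i (by omega)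
    rw [show i + 1 = m by omega, hxm, hy1 m le_rfl, show m + m + 2 = 2 * m + 2 by omega]
    exact cons_step_three (hone 1 (by omega) (by omega) (by omega) (by omega) (by omega)) hr
      2 1 0 (2 * m + 1) (2 * m + 3) 0
      (by omega) (by omega)
      ((H2 2 (2 * m + 2) (by omega) (by omega) (by omega) (by omega)).trans (by congr 1; omega))
      (by congr 1; omega)
      ((Hm (by omega)).trans (H3 _ _ (by omega) (by omega) (by omega) (by omega))) rfl
  rcases Nat.lt_or_ge i (m + 1) with c3 | c3
  · obtain rfl : i = m := by omega
    rw [hxm, hy0, hx2 _ (by omega), hy1 _ le_rfl, show i + 1 - i = 1 by omega,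
      show i + i + 2 = 2 * i + 2 by omega]
    exact cons_step_three (hone 1 (by omega) (by omega) (by omega) (by omega) (by omega)) h0
      1 0 2 (2 * i + 2) 1 (2 * i + 2) (by omega) (by omega) rfl rfl
      (H0 (by omega)).symm (H2 _ _ (by omega) (by omega) (by omega) (by omega))
  have e1 := hx2 i (by omega)
  have e2 := hx2 (i + 1) (by omega)
  rcases Nat.lt_or_ge i (m + 2) with c4 | c4
  · obtain rfl : i = m + 1 := by omega
    rw [hy0, show x (m + 1) = 1 by omega, show x (m + 1 + 1) = 2 by omega,
      show y (m + 1 + 1) = 2 * m + 2 by rw [hy2 _ (by omega) (by omega)]; omega]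
    exact cons_step_three (hone 2 (by omega) (by omega) (by omega) (by omega) (by omega)) hr
      1 3 2 0 (2 * m + 1) (2 * m + 3) (by omega) (by omega) rfl rfl
      (H2 _ _ (by omega) (by omega) (by omega) (by omega))
      ((H2 2 (2 * m + 2) (by omega) (by omega) (by omega) (by omega)).trans
        (H3 _ _ (by omega) (by omega) (by omega) (by omega)))
  rcases Nat.lt_or_ge (i + 1) (2 * m + 2) with c5 | c5
  · have e3 := hy2 i (by omega) (by omega)
    have e4 := hy2 (i + 1) (by omega) (by omega)
    exact cons_step_three (hone _ (by omega) (by omega) (by omega) (by omega) (by omega))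
      (hone _ (by omega) (by omega) (by omega) (by omega) (by omega))
      (x i) (x (i + 1)) (x (i + 1) + 1) (y i) (y (i + 1)) (y (i + 1) - 1)
      (by omega) (by omega) rfl rfl (H2 _ _ (by omega) (by omega) (by omega) (by omega))
      (H2 _ _ (by omega) (by omega) (by omega) (by omega))
  rcases Nat.lt_or_ge i (2 * m + 2) with c6 | c6
  · have e3 := hy2 i (by omega) (by omega)
    rw [hy3 (i + 1) (by omega), show x (i + 1) = m + 2 by omega,
      show 5 * m + 5 - (i + 1) = 3 * m + 3 by omega]
    exact cons_step_two hz hh (m + 1) (m + 3) (3 * m + 2) (3 * m + 2)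
      (by omega) (by omega) (by congr 1; omega)
      ((H3 (m + 3) _ (by omega) (by omega) (by omega) (by omega)).symm.trans (by congr 1; omega))
      (H3 _ _ (by omega) (by omega) (by omega) (by omega))
  have e3 := hy3 i (by omega)
  have e4 := hy3 (i + 1) (by omega)
  rcases Nat.lt_or_ge (i + 1) (3 * m + 2) with c7 | c7
  · exact cons_step_three (hone _ (by omega) (by omega) (by omega) (by omega) (by omega))
      (hone _ (by omega) (by omega) (by omega) (by omega) (by omega))
      (x i) (x (i + 1)) (x (i + 1) + 1) (y i) (y (i + 1)) (y (i + 1) - 1)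
      (by omega) (by omega) rfl rfl (H3 _ _ (by omega) (by omega) (by omega) (by omega))
      (H3 _ _ (by omega) (by omega) (by omega) (by omega))
  · rw [show x (i + 1) = 2 * m + 2 by omega, show y (i + 1) = 2 * m + 3 by omega]
    exact cons_step_three hr hr' (2 * m + 1) (2 * m + 3) 0 (2 * m + 4) (2 * m + 2) 0
      (by omega) (by omega) (by congr 1; omega) (by congr 1; omega)
      (H3 _ _ (by omega) (by omega) (by omega) (by omega)).symm rfl

end Waves

/-! ### Separation times on the contraction: the periodic family and the sporadic strings -/

section PeriodicWave

variable {κ : Type*} {nb : ℕ → Multiset ℕ} {f : ℕ → κ}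

-- The positions form three strands: $1,\dots,m$, then $m+1,\dots,2m$, and $2m+4,\dots,3m+3$ beyond
-- the block X1̂X, with zeros at every third place. In the first phase the wave runs along the
-- middle strand and compares each position with one nearby of the same degree: a zero with the next
-- zero, a 1 with the other 1 of its block or with the first 1 of the next block. The last zero,
-- $2m$, is compared with the hat. Then come two reflections: $a+b=2m+1$ from $(0,2m+1)$ to
-- $(m,m+1)$, and $a+b=4m+4$ from $(m+1,3m+3)$ to $(2m+1,2m+3)$.
set_option maxHeartbeats 2000000 in
theorem separation_family4 (m : ℕ) (hm : m % 3 = 1) (h0 : nb 0 = {1, 2 * m + 1, 2 * m + 1})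
    (hz1 : ∀ i j, i + j = m → 1 ≤ i → j % 3 = 0 → nb i = {i - 1, i + 1})
    (ho1 : ∀ i j, i + j = m → 1 ≤ i → j % 3 ≠ 0 → nb i = {i - 1, i + 1, i})
    (hz2 : ∀ i j, i = m + 1 + j → j < m → j % 3 = 0 → nb i = {i - 1, i + 1})
    (ho2 : ∀ i j, i = m + 1 + j → j < m → j % 3 ≠ 0 → nb i = {i - 1, i + 1, i})
    (hz3 : ∀ i j, i + j = 3 * m + 3 → 1 ≤ j → j < m → j % 3 = 0 → nb i = {i - 1, i + 1})
    (ho3 : ∀ i j, i + j = 3 * m + 3 → 1 ≤ j → j < m → j % 3 ≠ 0 → nb i = {i - 1, i + 1, i})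
    (hl : nb (3 * m + 3) = {3 * m + 2, 3 * m + 3})
    (hr : nb (2 * m + 1) = {2 * m, 2 * m + 2, 0})
    (hx : nb (2 * m + 2) = {2 * m + 1, 2 * m + 3, 3 * m + 4})
    (hr' : nb (2 * m + 3) = {2 * m + 2, 2 * m + 4, 0})
    (hh : nb (3 * m + 4) = {2 * m + 2, 2 * m + 2}) (t : ℕ) :
    mchi nb t (2 * m + 1) = mchi nb t (2 * m + 3) ↔ t < 3 * m + 4 := by
  obtain ⟨x, hx0, hx1, hx2⟩ : ∃ x : ℕ → ℕ, x 0 = m + 1 ∧ (∀ i, 1 ≤ i → i ≤ m + 1 → x i = m + i) ∧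
      ∀ i, m + 2 ≤ i → x i = i - m - 2 :=
    ⟨fun i => if i = 0 then m + 1 else if i ≤ m + 1 then m + i else i - m - 2,
      by grind, by grind, by grind⟩
  obtain ⟨y, hy0, hyh, hyz, hy1, hy2, hy3, hy4⟩ : ∃ y : ℕ → ℕ, y 0 = m + 2 ∧ y m = 3 * m + 4 ∧
      (∀ i, 1 ≤ i → i < m → i % 3 = 1 → y i = m + i + 3) ∧
      (∀ i, 1 ≤ i → i ≤ m + 1 → i % 3 = 2 → y i = m + i + 1) ∧
      (∀ i, 1 ≤ i → i ≤ m + 1 → i % 3 = 0 → y i = m + i + 2) ∧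
      (∀ i, m + 2 ≤ i → i ≤ 2 * m + 2 → y i = 3 * m + 3 - i) ∧
      (∀ i, 2 * m + 3 ≤ i → y i = 5 * m + 6 - i) :=
    ⟨fun i => if i = 0 then m + 2 else if i = m then 3 * m + 4 else if i ≤ m + 1 then
      (if i % 3 = 1 then m + i + 3 else if i % 3 = 2 then m + i + 1 else m + i + 2) else
      if i ≤ 2 * m + 2 then 3 * m + 3 - i else 5 * m + 6 - i,
      by grind, by grind, by grind, by grind, by grind, by grind, by grind⟩
  -- For `m = 1` the middle strand is the single zero `m + 1`, so `m + 2` is already the first X;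
  -- otherwise it carries a 1. Both have degree three, which is all the start of the wave needs.
  have hr2 : nb (m + 2) = {m + 1, m + 3, m + 2} ∨ nb (m + 2) = {m + 1, m + 3, 0} := by
    rcases (show m = 1 ∨ 1 < m by omega) with rfl | h
    · exact Or.inr hr
    · exact Or.inl (ho2 (m + 2) 1 (by omega) h (by omega))
  have key := mchi_wave nb 0 (3 * m + 3) x y (fun _ _ => rfl) ?_ ?_ t (3 * m + 3) le_rfl
  · rw [hx2 _ (by omega), hy4 _ (by omega), show 3 * m + 3 - m - 2 = 2 * m + 1 by omega,
      show 5 * m + 6 - (3 * m + 3) = 2 * m + 3 by omega] at key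
    rw [key]; omega
  · rw [hx0, hy0]
    refine mchi_one_ne ?_
    rcases hr2 with h | h <;> simp [h, hz2 (m + 1) 0 (by omega) (by omega) (by omega)]
  intro i hi t H
  generalize mchi nb t = f at H ⊢
  have H1 : ∀ a b, b = a + 1 → (a - m) % 3 = 2 → i + m < a → a ≤ 2 * m + 1 → f a = f b :=
    fun a b hb h0 h1 h2 => by
      have := H (a - m) (by omega) (by omega)
      rw [hx1 _ (by omega) (by omega), hy1 _ (by omega) (by omega) h0] at this
      convert this using 2 <;> omega
  have H1' : ∀ a b, b = a + 2 → (a - m) % 3 = 0 → i + m < a → a ≤ 2 * m + 1 → f a = f b :=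
    fun a b hb h0 h1 h2 => by
      have := H (a - m) (by omega) (by omega)
      rw [hx1 _ (by omega) (by omega), hy2 _ (by omega) (by omega) h0] at this
      convert this using 2 <;> omega
  have H2 : ∀ a b, a + b = 2 * m + 1 → a ≤ m → i ≤ m + 1 + a → f a = f b :=
    fun a b hb h1 h2 => by
      have := H (a + m + 2) (by omega) (by omega)
      rw [hx2 _ (by omega), hy3 _ (by omega) (by omega)] at this
      convert this using 2 <;> omega
  have H3 : ∀ a b, a + b = 4 * m + 4 → m + 1 ≤ a → a ≤ 2 * m + 1 → i ≤ m + 1 + a → f a = f b :=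
    fun a b hb h1 h2 h3 => by
      have := H (a + m + 2) (by omega) (by omega)
      rw [hx2 _ (by omega), hy4 _ (by omega)] at this
      convert this using 2 <;> omega
  -- separating the levels of equal degree from each other
  rcases Nat.lt_or_ge i 1 with c0 | c0
  · obtain rfl : i = 0 := by omega
    rw [hx0, hy0, show x (0 + 1) = m + 1 from hx1 1 le_rfl (by omega)]
    have hz := hz2 (m + 1) 0 (by omega) (by omega) (by omega)
    rcases (show m = 1 ∨ 1 < m by omega) with h | h
    · subst h
      exact cons_step_two hz (by rw [hyh]; exact hh) 1 3 4 4 (by omega) (by omega)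
        (H2 1 2 (by omega) (by omega) (by omega)) (H1 3 4 rfl rfl (by omega) (by omega)).symm
        (H1 3 4 rfl rfl (by omega) (by omega))
    · have e : y (0 + 1) = m + 1 + 3 := hyz 1 le_rfl h (by omega)
      have q := H1 (m + 2) (m + 3) rfl (by omega) (by omega) (by omega)
      have q' := H1' (m + 3) (m + 5) rfl (by omega) (by omega) (by omega)
      exact cons_step_two hz (hz2 _ 3 (by omega) (by omega) (by omega)) m (m + 2) (m + 3) (m + 5)
        (by omega) (by omega) (H2 _ _ (by omega) (by omega) (by omega)) q.symm (q.trans q')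
  rcases Nat.lt_or_ge i (m + 1) with c1 | c1
  · have e1 := hx1 i (by omega) (by omega)
    have e2 := hx1 (i + 1) (by omega) (by omega)
    obtain h | h | h : i % 3 = 0 ∨ i % 3 = 1 ∨ i % 3 = 2 := by omega
    · have e3 := hy2 i (by omega) (by omega) h
      have q := H1 (m + i + 2) (m + i + 3) rfl (by omega) (by omega) (by omega)
      rcases (show i + 1 = m ∨ i + 1 < m by omega) with h' | h'
      · have e4 : y (i + 1) = 3 * m + 4 := by rw [h', hyh]
        rw [e4]
        have q2 : f (m + i + 2) = f (2 * m + 2) := by rw [q]; congr 1; omega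
        exact cons_step_two (hz2 _ i (by omega) (by omega) h) hh (m + i) (m + i + 2)
          (2 * m + 2) (2 * m + 2) (by omega) (by omega) (by congr 1; omega)
          (by rw [← q2, e3]) q2
      · have e4 := hyz (i + 1) (by omega) (by omega) (by omega)
        have q' := H1' (m + i + 3) (m + i + 5) rfl (by omega) (by omega) (by omega)
        exact cons_step_two (hz2 _ i (by omega) (by omega) h) (hz2 _ (i + 3) (by omega)
          (by omega) (by omega)) (m + i) (m + i + 2) (m + i + 3) (m + i + 5) (by omega) (by omega)
          (by congr 1; omega) (by rw [← q, e3]) (q.trans q')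
    · have e4 := hy1 (i + 1) (by omega) (by omega) (by omega)
      have q := H1 (m + i + 1) (m + i + 2) rfl (by omega) (by omega) (by omega)
      rcases (show i = m ∨ i < m by omega) with h' | h'
      · subst h'
        rw [hyh, show x (i + 1) = 2 * i + 1 by omega, show y (i + 1) = 2 * i + 2 by omega]
        refine cons_step_three hr hx (2 * i) (2 * i + 2) 0 (3 * i + 4) (2 * i + 1) (2 * i + 3)
          (by omega) (by omega) (by congr 1; omega) rfl ?_
          ((H2 _ _ (by omega) (by omega) (by omega)).trans
            (H3 (2 * i + 1) _ (by omega) (by omega) (by omega) (by omega)))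
        rw [show 2 * i + 1 = i + i + 1 by omega, q]; congr 1; omega
      · have e3 := hyz i (by omega) h' h
        exact cons_step_three (ho2 _ i (by omega) (by omega) (by omega))
          (ho2 _ (i + 1) (by omega) (by omega) (by omega)) (m + i) (m + i + 1) (m + i + 2)
          (m + i + 3) (m + i + 2) (m + i + 1) (by omega) (by omega) (by congr 1; omega)
          (by congr 1; omega) q q.symm
    · have e3 := hy1 i (by omega) (by omega) h
      have e4 := hy2 (i + 1) (by omega) (by omega) (by omega)
      have q := H1' (m + i + 1) (m + i + 3) rfl (by omega) (by omega) (by omega)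
      have q' := H1 (m + i + 3) (m + i + 4) rfl (by omega) (by omega) (by omega)
      rcases (show i + 2 = m ∨ i + 2 < m by omega) with h' | h'
      · have e5 : y (i + 1) = 2 * m + 1 := by omega
        rw [e5]
        refine cons_step_three (ho2 _ i (by omega) (by omega) (by omega)) hr
          (m + i) (m + i + 2) (m + i + 1) (2 * m + 2) (2 * m) 0
          (by omega) (by omega) (by congr 1; omega) ?_ (by congr 1; omega) ?_
        · rw [e3, q, q']; congr 1; omega
        · rw [q, H2 0 (2 * m + 1) (by omega) (by omega) (by omega)]; congr 1; omega
      · exact cons_step_three (ho2 _ i (by omega) (by omega) (by omega))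
          (ho2 _ (i + 2) (by omega) (by omega) (by omega)) (m + i) (m + i + 2) (m + i + 1)
          (m + i + 4) (m + i + 2) (m + i + 3) (by omega) (by omega) (by congr 1; omega)
          (by rw [← q', ← q, e3]) rfl q
  -- separating the first strand from the other two
  have e2 := hx2 (i + 1) (by omega)
  rcases Nat.lt_or_ge i (m + 2) with c2 | c2
  · have e1 := hx1 i (by omega) (by omega)
    have e3 := hy1 i (by omega) (by omega) (by omega)
    have e4 := hy3 (i + 1) (by omega) (by omega)
    rw [show x i = 2 * m + 1 by omega, show x (i + 1) = 0 by omega,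
      show y i = 2 * m + 2 by omega, show y (i + 1) = 2 * m + 1 by omega]
    exact cons_step_three h0 hr (2 * m + 1) 1 (2 * m + 1) (2 * m + 2) (2 * m) 0
      (by omega) (by omega) rfl rfl (H2 _ _ (by omega) (by omega) (by omega))
      (H2 _ _ (by omega) (by omega) (by omega)).symm
  have e1 := hx2 i (by omega)
  rcases Nat.lt_or_ge i (2 * m + 2) with c3 | c3
  · have e3 := hy3 i (by omega) (by omega)
    have e4 := hy3 (i + 1) (by omega) (by omega)
    have q : f (x (i + 1) + 1) = f (y (i + 1) - 1) := by
      rcases (show i = 2 * m + 1 ∨ i < 2 * m + 1 by omega) with h | h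
      · exact (H2 _ _ (by omega) (by omega) (by omega)).symm
      · exact H2 _ _ (by omega) (by omega) (by omega)
    by_cases h : (m - x (i + 1)) % 3 = 0
    · exact cons_step_two (hz1 _ (m - x (i + 1)) (by omega) (by omega) h)
        (hz2 _ (m - x (i + 1)) (by omega) (by omega) h) (x i) (x (i + 1) + 1) (y i) (y (i + 1) - 1)
        (by omega) (by omega) rfl rfl q
    · exact cons_step_three (ho1 _ (m - x (i + 1)) (by omega) (by omega) h)
        (ho2 _ (m - x (i + 1)) (by omega) (by omega) h)
        (x i) (x (i + 1) + 1) (x (i + 1)) (y i) (y (i + 1) - 1) (y (i + 1))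
        (by omega) (by omega) rfl rfl q (H2 _ _ (by omega) (by omega) (by omega))
  have e4 := hy4 (i + 1) (by omega)
  -- separating the remaining two strands
  rcases Nat.lt_or_ge i (2 * m + 3) with c4 | c4
  · have e3 := hy3 i (by omega) (by omega)
    rw [show x i = m by omega, show x (i + 1) = m + 1 by omega,
      show y i = m + 1 by omega, show y (i + 1) = 3 * m + 3 by omega]
    -- The loop at the last position stands in for the missing neighbour: `3 * m + 3` is its own
    -- neighbour and still has the colour of `m + 1`, the second vertex of the preceding pair.
    exact cons_step_two (hz2 _ 0 (by omega) (by omega) (by omega)) hl m (m + 2)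
      (3 * m + 3) (3 * m + 2) (by omega) (by omega) rfl
      (H3 _ _ (by omega) (by omega) (by omega) (by omega)).symm
      (H3 _ _ (by omega) (by omega) (by omega) (by omega))
  have e3 := hy4 i (by omega)
  rcases Nat.lt_or_ge (i + 1) (3 * m + 3) with c5 | c5
  · have q := H3 (x (i + 1)) (y (i + 1)) (by omega) (by omega) (by omega) (by omega)
    have q' := H3 (x (i + 1) + 1) (y (i + 1) - 1) (by omega) (by omega) (by omega) (by omega)
    by_cases h : (x (i + 1) - m - 1) % 3 = 0
    · exact cons_step_two (hz2 _ (x (i + 1) - m - 1) (by omega) (by omega) h)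
        (hz3 _ (x (i + 1) - m - 1) (by omega) (by omega) (by omega) h)
        (x i) (x (i + 1) + 1) (y i) (y (i + 1) - 1) (by omega) (by omega) rfl rfl q'
    · exact cons_step_three (ho2 _ (x (i + 1) - m - 1) (by omega) (by omega) h)
        (ho3 _ (x (i + 1) - m - 1) (by omega) (by omega) (by omega) h)
        (x i) (x (i + 1) + 1) (x (i + 1)) (y i) (y (i + 1) - 1) (y (i + 1))
        (by omega) (by omega) rfl rfl q' q
  · rw [show x (i + 1) = 2 * m + 1 by omega, show y (i + 1) = 2 * m + 3 by omega]
    exact cons_step_three hr hr' (2 * m) (2 * m + 2) 0 (2 * m + 4) (2 * m + 2) 0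
      (by omega) (by omega) (by congr 1; omega) (by congr 1; omega) rfl rfl

/-- The string is too short for a uniform pattern, so the wave is an explicit list: the hat $6$
against position $3$ (degrees two and three), then $(1,3),(2,4),(2,0),(3,4),(4,5)$. The default of
`getD` is never reached. The other sporadic strings are treated alike. -/
theorem separation_family0
    (n0 : nb 0 = {1, 4, 4}) (n1 : nb 1 = {0, 2, 6}) (n2 : nb 2 = {1, 3, 2}) (n3 : nb 3 = {2, 4, 3}) (n4 : nb 4 = {3, 5, 0}) (n5 : nb 5 = {4, 5, 0}) (n6 : nb 6 = {1, 1})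
    (t : ℕ) : mchi nb t 4 = mchi nb t 5 ↔ t < 6 := by
  have key := mchi_wave nb 0 5 (fun i => [6, 1, 2, 2, 3, 4].getD i 0)
    (fun i => [3, 3, 4, 0, 4, 5].getD i 0) (fun _ _ => rfl)
    (mchi_one_ne (by simp [n6, n3])) ?_ t 5 le_rfl
  · rw [Nat.lt_succ_iff, ← Nat.zero_add 5]
    exact key
  intro i hi t H
  generalize mchi nb t = f at H ⊢
  interval_cases i
  · have h2 : f 2 = f 4 := H 2 (by norm_num) (by norm_num)
    have h3 : f 2 = f 0 := H 3 (by norm_num) (by norm_num)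
    exact cons_step_three n1 n3 6 0 2 3 2 4 (by decide) (by decide) rfl rfl
      h3.symm h2
  · have h3 : f 2 = f 0 := H 3 (by norm_num) (by norm_num)
    have h4 : f 3 = f 4 := H 4 (by norm_num) (by norm_num)
    have h5 : f 4 = f 5 := H 5 (by norm_num) (by norm_num)
    exact cons_step_three n2 n4 1 3 2 3 5 0 (by decide) (by decide) rfl rfl
      (h4.trans h5) h3
  · have h4 : f 3 = f 4 := H 4 (by norm_num) (by norm_num)
    exact cons_step_three n2 n0 2 1 3 4 1 4 (by decide) (by decide) rfl rfl
      rfl h4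
  · have h4 : f 3 = f 4 := H 4 (by norm_num) (by norm_num)
    have h5 : f 4 = f 5 := H 5 (by norm_num) (by norm_num)
    exact cons_step_three n3 n4 2 4 3 0 3 5 (by decide) (by decide) rfl rfl
      h4.symm (h4.trans h5)
  · exact cons_step_three n4 n5 3 5 0 4 5 0 (by decide) (by decide) rfl rfl
      rfl rfl

theorem separation_family1_sporadic
    (n0 : nb 0 = {1, 2, 2}) (n1 : nb 1 = {0, 2}) (n2 : nb 2 = {1, 3, 0}) (n3 : nb 3 = {2, 4, 3}) (n4 : nb 4 = {3, 5, 0}) (n5 : nb 5 = {4, 4})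
    (t : ℕ) : mchi nb t 2 = mchi nb t 4 ↔ t < 5 := by
  have key := mchi_wave nb 0 4 (fun i => [1, 2, 0, 1, 2].getD i 0)
    (fun i => [2, 3, 4, 5, 4].getD i 0) (fun _ _ => rfl)
    (mchi_one_ne (by simp [n1, n2])) ?_ t 4 le_rfl
  · rw [Nat.lt_succ_iff, ← Nat.zero_add 4]
    exact key
  intro i hi t H
  generalize mchi nb t = f at H ⊢
  interval_cases i
  · have h1 : f 2 = f 3 := H 1 (by norm_num) (by norm_num)
    have h2 : f 0 = f 4 := H 2 (by norm_num) (by norm_num)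
    have h4 : f 2 = f 4 := H 4 (by norm_num) (by norm_num)
    exact cons_step_three n2 n3 1 3 0 2 4 3 (by decide) (by decide) rfl rfl
      (h1.symm.trans h4) ((h2.trans h4.symm).trans h1)
  · have h2 : f 0 = f 4 := H 2 (by norm_num) (by norm_num)
    have h3 : f 1 = f 5 := H 3 (by norm_num) (by norm_num)
    have h4 : f 2 = f 4 := H 4 (by norm_num) (by norm_num)
    exact cons_step_three n0 n4 2 1 2 3 5 0 (by decide) (by decide) rfl rfl
      h3 (h4.trans h2.symm)
  · have h4 : f 2 = f 4 := H 4 (by norm_num) (by norm_num)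
    exact cons_step_two n1 n5 0 2 4 4 (by decide) (by decide) rfl rfl
      h4
  · exact cons_step_three n2 n4 1 3 0 5 3 0 (by decide) (by decide) rfl rfl
      rfl rfl

theorem separation_family2_sporadic
    (n0 : nb 0 = {1, 4, 4}) (n1 : nb 1 = {0, 2, 1}) (n2 : nb 2 = {1, 3, 2}) (n3 : nb 3 = {2, 4}) (n4 : nb 4 = {3, 5, 0}) (n5 : nb 5 = {4, 6, 0}) (n6 : nb 6 = {5, 5})
    (t : ℕ) : mchi nb t 4 = mchi nb t 5 ↔ t < 6 := by
  have key := mchi_wave nb 0 5 (fun i => [0, 1, 1, 2, 3, 4].getD i 0)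
    (fun i => [3, 4, 0, 5, 6, 5].getD i 0) (fun _ _ => rfl)
    (mchi_one_ne (by simp [n0, n3])) ?_ t 5 le_rfl
  · rw [Nat.lt_succ_iff, ← Nat.zero_add 5]
    exact key
  intro i hi t H
  generalize mchi nb t = f at H ⊢
  interval_cases i
  · have h2 : f 1 = f 0 := H 2 (by norm_num) (by norm_num)
    have h3 : f 2 = f 5 := H 3 (by norm_num) (by norm_num)
    exact cons_step_three n1 n4 0 2 1 3 5 0 (by decide) (by decide) rfl rfl
      h3 h2
  · have h2 : f 1 = f 0 := H 2 (by norm_num) (by norm_num)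
    have h3 : f 2 = f 5 := H 3 (by norm_num) (by norm_num)
    have h5 : f 4 = f 5 := H 5 (by norm_num) (by norm_num)
    exact cons_step_three n1 n0 1 0 2 4 1 4 (by decide) (by decide) rfl rfl
      h2.symm (h3.trans h5.symm)
  · have h3 : f 2 = f 5 := H 3 (by norm_num) (by norm_num)
    have h4 : f 3 = f 6 := H 4 (by norm_num) (by norm_num)
    have h5 : f 4 = f 5 := H 5 (by norm_num) (by norm_num)
    exact cons_step_three n2 n5 1 3 2 0 6 4 (by decide) (by decide) rfl rfl
      h4 (h3.trans h5.symm)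
  · have h5 : f 4 = f 5 := H 5 (by norm_num) (by norm_num)
    exact cons_step_two n3 n6 2 4 5 5 (by decide) (by decide) rfl rfl
      h5
  · have h5 : f 4 = f 5 := H 5 (by norm_num) (by norm_num)
    exact cons_step_three n4 n5 3 5 0 6 4 0 (by decide) (by decide) rfl rfl
      h5.symm rfl

end PeriodicWave

/-! ### Strings with one hat: contraction of pairs and lifting of the wave -/

theorem neighborFinset_val_eq {V : Type*} [Fintype V] (G : SimpleGraph V) [DecidableRel G.Adj]
    {v : V} {l : List V} (hl : l.Nodup) (h : ∀ u, u ∈ l ↔ G.Adj v u) :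
    (G.neighborFinset v).val = l := by
  have : G.neighborFinset v = ⟨l, hl⟩ := by
    ext u
    rw [SimpleGraph.mem_neighborFinset, ← h u]
    rfl
  rw [this]

/-- The pair at position `i` has an edge left inside after the subdivision. -/
def InnerLeft (L : ℕ → HatLetter) (ℓ i : ℕ) : Prop :=
  L i = .one ∨ (i + 1 = ℓ ∧ L i ≠ .XHat)

instance (L : ℕ → HatLetter) (ℓ i : ℕ) : Decidable (InnerLeft L ℓ i) := by
  unfold InnerLeft; infer_instance

/-- Neighbours in the multigraph obtained by contracting every pair to its position; the only
hat, at position `h`, becomes the vertex `ℓ`. -/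
def pairNeighbours (L : ℕ → HatLetter) (ℓ r r' h i : ℕ) : Multiset ℕ :=
  if i < ℓ then
    (((if 0 < i then [i - 1] else []) ++ (if i + 1 < ℓ then [i + 1] else []) ++
      (if InnerLeft L ℓ i then [i] else []) ++ (if i = h then [ℓ] else []) ++
      (if i = r ∨ i = r' then [0] else []) ++ (if i = 0 then [r, r] else []) : List ℕ) :
        Multiset ℕ)
  else {h, h}

/-- The string of length `ℓ` with letters `L` has its letters `X` at positions `r < r'`, exactly
one hat, at position `h`, and the pair at `h` is adjacent in the base graph. -/
structure SingleHat (L : ℕ → HatLetter) (ℓ r r' h : ℕ) : Prop where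
  two_le : 2 ≤ r
  lt : r < r'
  lt_length : r' < ℓ
  hat_lt : h < ℓ
  S_iff : ∀ i < ℓ, L i = .S ↔ i = 0
  X_iff : ∀ i < ℓ, (L i).base = .X ↔ i = r ∨ i = r'
  hat_iff : ∀ i < ℓ, (L i).isHat = true ↔ i = h
  hat_adj : L h = .oneHat ∨ h + 1 = ℓ
  last_ne : ∀ i, i + 1 = ℓ → L i ≠ .one

namespace SingleHat

variable {L : ℕ → HatLetter} {ℓ r r' h : ℕ}

/-- The string as a function on `Fin ℓ`. -/
abbrev str (L : ℕ → HatLetter) (ℓ : ℕ) : Fin ℓ → HatLetter := fun i => L i.val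

theorem isFirstX_iff (H : SingleHat L ℓ r r' h) (i : Fin ℓ) :
    IsFirstX (baseString (str L ℓ)) i ↔ i.val = r := by
  have := H.lt; have := H.lt_length
  constructor
  · rintro ⟨h1, k, hk, h2⟩
    have a := (H.X_iff _ i.2).1 h1
    have b := (H.X_iff _ k.2).1 h2
    have : i.val < k.val := hk
    omega
  · intro hi
    refine ⟨(H.X_iff _ i.2).2 (Or.inl hi), ⟨r', H.lt_length⟩, ?_,
      (H.X_iff _ H.lt_length).2 (Or.inr rfl)⟩
    change i.val < r'
    omega

theorem isSecondX_iff (H : SingleHat L ℓ r r' h) (i : Fin ℓ) :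
    IsSecondX (baseString (str L ℓ)) i ↔ i.val = r' := by
  have := H.lt; have := H.lt_length
  constructor
  · rintro ⟨h1, k, hk, h2⟩
    have a := (H.X_iff _ i.2).1 h1
    have b := (H.X_iff _ k.2).1 h2
    have : k.val < i.val := hk
    omega
  · intro hi
    refine ⟨(H.X_iff _ i.2).2 (Or.inr hi), ⟨r, by omega⟩, ?_,
      (H.X_iff r (by omega)).2 (Or.inl rfl)⟩
    change r < i.val
    omega

theorem innerLeft_iff (H : SingleHat L ℓ r r' h) (i : Fin ℓ) :
    (if (str L ℓ i).isHat = true then 1 else 0) < innerEdges (baseString (str L ℓ)) i ↔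
      InnerLeft L ℓ i.val := by
  have hl := H.last_ne i.val
  have hlt := i.2
  unfold innerEdges InnerLeft baseString str
  by_cases hi : i.val + 1 = ℓ <;> cases hL : L i.val <;>
    simp_all [HatLetter.base, HatLetter.isHat]

theorem isHatString (H : SingleHat L ℓ r r' h) : IsHatString (str L ℓ) := by
  have := H.lt; have := H.lt_length; have := H.two_le
  refine ⟨⟨by omega, fun i => ?_, ⟨r, by omega⟩, ⟨r', H.lt_length⟩, H.lt, fun i => ?_⟩,
    fun i hi => ?_⟩
  · rw [← H.S_iff _ i.2]
    change (L i.val).base = Letter.S ↔ _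
    cases L i.val <;> simp [HatLetter.base]
  · rw [Fin.ext_iff, Fin.ext_iff]
    exact H.X_iff _ i.2
  · have hih : i.val = h := (H.hat_iff _ i.2).1 hi
    refine ⟨by simp, Or.inl (Or.inr ⟨rfl, ?_⟩)⟩
    have := H.hat_adj
    rw [← hih] at this
    unfold innerEdges baseString str
    rcases this with h | h <;> simp [h, HatLetter.base]

theorem card_vertex (H : SingleHat L ℓ r r' h) :
    Fintype.card (HatVertex (str L ℓ)) = 2 * ℓ + 1 := by
  have : Fintype.card {i : Fin ℓ // (str L ℓ i).isHat = true} = 1 := by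
    rw [Fintype.card_eq_one_iff]
    refine ⟨⟨⟨h, H.hat_lt⟩, (H.hat_iff h H.hat_lt).2 rfl⟩, fun y => ?_⟩
    exact Subtype.ext (Fin.ext ((H.hat_iff _ y.1.2).1 y.2))
  rw [Fintype.card_sum, this, Fintype.card_prod, Fintype.card_fin, Fintype.card_fin]
  ring

theorem adj_inl_inl (H : SingleHat L ℓ r r' h) (i i' : Fin ℓ) (j j' : Fin 2) :
    (hatGraph (str L ℓ)).Adj (Sum.inl (i, j)) (Sum.inl (i', j')) ↔
      (i.val = i'.val + 1 ∧ j' = j) ∨ (i'.val = i.val + 1 ∧ j' = j) ∨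
      (i' = i ∧ j' ≠ j ∧ InnerLeft L ℓ i.val) ∨
      (i.val = r ∧ i'.val = 0 ∧ j' = 0) ∨ (i.val = r' ∧ i'.val = 0 ∧ j' = 1) ∨
      (i'.val = r ∧ i.val = 0 ∧ j = 0) ∨ (i'.val = r' ∧ i.val = 0 ∧ j = 1) := by
  have := H.lt; have := H.two_le
  have e1 : HatEdge (str L ℓ) (Sum.inl (i, j)) (Sum.inl (i', j')) ↔
      ((i'.val = i.val + 1 ∧ j' = j) ∨ (i.val = r ∧ i'.val = 0 ∧ j' = 0) ∨
        (i.val = r' ∧ i'.val = 0 ∧ j' = 1)) ∨ (i = i' ∧ InnerLeft L ℓ i.val) := by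
    rw [← H.isFirstX_iff, ← H.isSecondX_iff, ← H.innerLeft_iff]; rfl
  have e2 : HatEdge (str L ℓ) (Sum.inl (i', j')) (Sum.inl (i, j)) ↔
      ((i.val = i'.val + 1 ∧ j = j') ∨ (i'.val = r ∧ i.val = 0 ∧ j = 0) ∨
        (i'.val = r' ∧ i.val = 0 ∧ j = 1)) ∨ (i' = i ∧ InnerLeft L ℓ i'.val) := by
    rw [← H.isFirstX_iff, ← H.isSecondX_iff, ← H.innerLeft_iff]; rfl
  rw [hatGraph, SimpleGraph.fromRel_adj, e1, e2, ne_eq, Sum.inl.injEq, Prod.mk.injEq]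
  constructor
  · rintro ⟨hne, ((h | h | h) | h) | ((h | h | h) | h)⟩ <;> grind
  · rintro (h | h | h | h | h | h | h) <;> grind

theorem adj_inl_inr (i : Fin ℓ) (j : Fin 2) (k) :
    (hatGraph (str L ℓ)).Adj (Sum.inl (i, j)) (Sum.inr k) ↔ i = k.1 := by
  rw [hatGraph, SimpleGraph.fromRel_adj]
  exact ⟨fun ⟨_, h⟩ => h.elim id False.elim, fun h => ⟨Sum.inl_ne_inr, Or.inl h⟩⟩

theorem not_adj_inr_inr (k k') :
    ¬ (hatGraph (str L ℓ)).Adj (Sum.inr k) (Sum.inr k') := by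
  rw [hatGraph, SimpleGraph.fromRel_adj]
  exact fun ⟨_, h⟩ => h.elim id id

/-- The neighbours of `v_{i,j}`. -/
def neighbourList (L : ℕ → HatLetter) (ℓ r r' : ℕ) (hr : r < ℓ) (hr' : r' < ℓ)
    (i : Fin ℓ) (j : Fin 2) : List (HatVertex (str L ℓ)) :=
  (if 0 < i.val then [Sum.inl (⟨i.val - 1, by omega⟩, j)] else []) ++
  (if hi : i.val + 1 < ℓ then [Sum.inl (⟨i.val + 1, hi⟩, j)] else []) ++
  (if InnerLeft L ℓ i.val then [Sum.inl (i, 1 - j)] else []) ++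
  (if hi : (str L ℓ i).isHat = true then [Sum.inr ⟨i, hi⟩] else []) ++
  (if i.val = r ∨ i.val = r' then
    [Sum.inl (⟨0, by omega⟩, if i.val = r then 0 else 1)] else []) ++
  (if i.val = 0 then
    [Sum.inl (if j = 0 then ⟨r, hr⟩ else ⟨r', hr'⟩, 0),
      Sum.inl (if j = 0 then ⟨r, hr⟩ else ⟨r', hr'⟩, 1)] else [])

theorem one_sub_iff (j j' : Fin 2) : j' = 1 - j ↔ j' ≠ j := by
  revert j j'; decide

theorem mem_neighbourList (H : SingleHat L ℓ r r' h) (i : Fin ℓ) (j : Fin 2)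
    (u : HatVertex (str L ℓ)) :
    u ∈ neighbourList L ℓ r r' (H.lt.trans H.lt_length) H.lt_length i j ↔
      (hatGraph (str L ℓ)).Adj (Sum.inl (i, j)) u := by
  have := H.lt; have := H.lt_length; have := H.two_le
  obtain ⟨i', j'⟩ | k := u
  · rw [H.adj_inl_inl]
    have hj : j = 0 ∨ j = 1 := by omega
    have hj' : j' = 0 ∨ j' = 1 := by omega
    simp only [neighbourList, List.mem_append, List.mem_ite_nil_right, List.mem_dite_nil_right,
      List.mem_cons, List.not_mem_nil, or_false, Sum.inl.injEq, Prod.mk.injEq, reduceCtorEq,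
      one_sub_iff, Fin.ext_iff (a := i'), exists_prop, and_false]
    have := i.2
    have := i'.2
    rcases hj with rfl | rfl <;> simp only [if_true, one_ne_zero, if_false] <;> grind
  · rw [adj_inl_inr]
    simp only [neighbourList, List.mem_append, List.mem_ite_nil_right, List.mem_dite_nil_right,
      List.mem_cons, List.not_mem_nil, or_false, reduceCtorEq, Sum.inr.injEq, and_false,
      exists_false, false_or]
    constructor
    · rintro ⟨_, rfl⟩; rfl
    · rintro rfl; exact ⟨k.2, rfl⟩

theorem nodup_neighbourList (H : SingleHat L ℓ r r' h) (i : Fin ℓ) (j : Fin 2) :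
    (neighbourList L ℓ r r' (H.lt.trans H.lt_length) H.lt_length i j).Nodup := by
  have := H.lt; have := H.lt_length; have := H.two_le
  have hnd : ∀ (p : Prop) [Decidable p] (a : HatVertex (str L ℓ)),
      (if p then [a] else []).Nodup := fun p _ a => by split_ifs <;> simp
  have hnd' : ∀ (p : Prop) [Decidable p] (a : p → HatVertex (str L ℓ)),
      (if h : p then [a h] else []).Nodup := fun p _ a => by split_ifs <;> simp
  have h2 : ∀ a : Fin ℓ, (if i.val = 0 then [(Sum.inl (a, 0) : HatVertex (str L ℓ)),
      Sum.inl (a, 1)] else []).Nodup := fun a => by split_ifs <;> simp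
  unfold neighbourList
  refine (((((hnd _ _).append (hnd' _ _) ?_).append (hnd _ _) ?_).append (hnd' _ _) ?_).append
    (hnd _ _) ?_).append (h2 _) ?_
  all_goals
    intro u h1 h2
    simp only [List.mem_append, List.mem_ite_nil_right, List.mem_dite_nil_right,
      List.mem_cons, List.not_mem_nil, or_false] at h1 h2
    grind -ring

/-- The position of a vertex, where the hat gets position `ℓ`. -/
def position (L : ℕ → HatLetter) (ℓ : ℕ) : HatVertex (str L ℓ) → ℕ :=
  Sum.elim (fun u => u.1.val) fun _ => ℓ

/-- Both lists are built in the same order, so they match entry by entry. Only at position $0$ does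
the contraction misreport: $v_{1,2}$ sees `r'` where `pairNeighbours` has `r`. This is the sole
purpose of `hf`. -/
theorem map_neighbourList (H : SingleHat L ℓ r r' h) (i : Fin ℓ) (j : Fin 2)
    {κ : Type*} (f : ℕ → κ) (hf : f r = f r') :
    (neighbourList L ℓ r r' (H.lt.trans H.lt_length) H.lt_length i j).map
        (fun u => f (position L ℓ u)) =
      ((pairNeighbours L ℓ r r' h i.val).map f) := by
  have hh := H.hat_iff i.val i.2
  rw [pairNeighbours, if_pos i.2, Multiset.map_coe, Multiset.coe_eq_coe]
  refine List.Perm.of_eq ?_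
  simp only [neighbourList, List.map_append]
  congr 1
  · congr 1
    · congr 1
      · congr 1
        · congr 1
          · split_ifs <;> rfl
          · split_ifs <;> rfl
        · split_ifs <;> rfl
      · change List.map _ (if hi : (L i.val).isHat = true then _ else _) = _
        split_ifs <;> first | rfl | tauto
    · split_ifs <;> rfl
  · split_ifs <;> simp [position, hf]

theorem neighborFinset_inr (H : SingleHat L ℓ r r' h) (k) :
    ((hatGraph (str L ℓ)).neighborFinset (Sum.inr k)).val =
      ([Sum.inl (⟨h, H.hat_lt⟩, 0), Sum.inl (⟨h, H.hat_lt⟩, 1)] :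
        List (HatVertex (str L ℓ))) := by
  have hk : k.1 = ⟨h, H.hat_lt⟩ := Fin.ext ((H.hat_iff _ k.1.2).1 k.2)
  refine neighborFinset_val_eq _ (by simp) fun u => ?_
  obtain ⟨i, j⟩ | k' := u
  · rw [SimpleGraph.adj_comm, adj_inl_inr, hk]
    have : j = 0 ∨ j = 1 := by omega
    rcases this with rfl | rfl <;> simp
  · simp [not_adj_inr_inr]

theorem neighborFinset_inl (H : SingleHat L ℓ r r' h) (i : Fin ℓ) (j : Fin 2) :
    ((hatGraph (str L ℓ)).neighborFinset (Sum.inl (i, j))).val =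
      neighbourList L ℓ r r' (H.lt.trans H.lt_length) H.lt_length i j :=
  neighborFinset_val_eq _ (H.nodup_neighbourList i j) (H.mem_neighbourList i j)

theorem map_neighborFinset (H : SingleHat L ℓ r r' h) (v : HatVertex (str L ℓ))
    {κ : Type*} (f : ℕ → κ) (hf : f r = f r') :
    ((hatGraph (str L ℓ)).neighborFinset v).val.map (fun u => f (position L ℓ u)) =
      (pairNeighbours L ℓ r r' h (position L ℓ v)).map f := by
  obtain ⟨i, j⟩ | k := v
  · rw [H.neighborFinset_inl, Multiset.map_coe]
    exact H.map_neighbourList i j f hf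
  · rw [H.neighborFinset_inr]
    have : pairNeighbours L ℓ r r' h (position L ℓ (Sum.inr k)) = {h, h} := if_neg (lt_irrefl ℓ)
    rw [this]
    rfl

/-- A constant colouring always identifies `r` with `r'`, so the contraction preserves degrees
unconditionally. -/
theorem degree_eq (H : SingleHat L ℓ r r' h) (v : HatVertex (str L ℓ)) :
    (hatGraph (str L ℓ)).degree v = (pairNeighbours L ℓ r r' h (position L ℓ v)).card := by
  have := congrArg Multiset.card (H.map_neighborFinset v (fun _ => ()) rfl)
  rwa [Multiset.card_map, Multiset.card_map] at this

theorem hat_ne_zero (H : SingleHat L ℓ r r' h) : h ≠ 0 := by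
  rintro rfl
  have h1 := (H.S_iff 0 H.hat_lt).2 rfl
  have h2 := (H.hat_iff 0 H.hat_lt).2 rfl
  rw [h1] at h2
  exact Bool.false_ne_true h2

theorem pairNeighbours_zero (H : SingleHat L ℓ r r' h) :
    pairNeighbours L ℓ r r' h 0 = {1, r, r} := by
  have := H.lt; have := H.lt_length; have := H.two_le; have := H.hat_ne_zero
  have h1 := (H.S_iff 0 (by omega)).2 rfl
  have hI : ¬ InnerLeft L ℓ 0 := by simp [InnerLeft, h1]; omega
  have : ¬ 0 = h := by omega
  have : ¬ (0 = r ∨ 0 = r') := by omega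
  have : 0 < ℓ := by omega
  have : 1 < ℓ := by omega
  simp [pairNeighbours, *]
  rfl

/-- The S-pair is where the two sides of the graph differ: this is what starts the second wave once
`r` and `r'` have different colours. -/
theorem neighbourList_zero (H : SingleHat L ℓ r r' h) (j : Fin 2) :
    (neighbourList L ℓ r r' (H.lt.trans H.lt_length) H.lt_length
        ⟨0, (Nat.zero_le _).trans_lt H.lt_length⟩ j).map (position L ℓ) =
      if j = 0 then [1, r, r] else [1, r', r'] := by
  have := H.lt; have := H.lt_length; have := H.two_le; have := H.hat_ne_zero
  have h1 := (H.S_iff 0 (by omega)).2 rfl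
  have hI : ¬ InnerLeft L ℓ 0 := by simp [InnerLeft, h1]; omega
  have : ¬ (0 = r ∨ 0 = r') := by omega
  have : ¬ (L 0).isHat = true := by rw [h1]; exact Bool.false_ne_true
  have : 0 < ℓ := by omega
  have : 1 < ℓ := by omega
  have hj : j = 0 ∨ j = 1 := by omega
  rcases hj with rfl | rfl <;> simp [neighbourList, position, HatLetter.isHat, *] <;> rfl

/-- The step of the second wave. Besides the predecessor on the same side, a vertex sees its
successor, possibly its partner and a hat, and possibly a vertex of the S-pair. The first two have
side-independent colours by `hg`; the last two are common neighbours of both vertices of the pair.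
-/
theorem map_neighbourList_succ {hr : r < ℓ} {hr' : r' < ℓ} {i : ℕ} (hi : i + 1 < ℓ) {κ : Type*}
    (g : HatVertex (str L ℓ) → κ)
    (hg : ∀ k (hk : k < ℓ), i < k → g (Sum.inl (⟨k, hk⟩, 0)) = g (Sum.inl (⟨k, hk⟩, 1)))
    (j : Fin 2) :
    (neighbourList L ℓ r r' hr hr' ⟨i + 1, hi⟩ j).map g =
      g (Sum.inl (⟨i, by omega⟩, j)) ::
        ((neighbourList L ℓ r r' hr hr' ⟨i + 1, hi⟩ 0).map g).tail := by
  have hj : j = 0 ∨ j = 1 := by omega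
  have h1 := hg (i + 1) hi (by omega)
  have h2 := fun hk => hg (i + 1 + 1) hk (by omega)
  rcases hj with rfl | rfl
  · simp [neighbourList]
  · simp only [neighbourList, List.map_append, Nat.succ_pos, if_true, List.map_cons, List.map_nil,
      List.cons_append, List.tail_cons, List.nil_append, Nat.add_one_sub_one, Nat.succ_ne_zero,
      if_false]
    congr 5
    · split_ifs with hk
      · simp [h2 hk]
      · rfl
    · split_ifs
      · simp [h1]
      · rfl

theorem card_pairNeighbours (H : SingleHat L ℓ r r' h) (i : ℕ) :
    (pairNeighbours L ℓ r r' h i).card = 2 ∨ (pairNeighbours L ℓ r r' h i).card = 3 := by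
  rcases Nat.eq_zero_or_pos i with rfl | h0
  · rw [H.pairNeighbours_zero]
    exact Or.inr rfl
  by_cases hi : i < ℓ
  · have hX := H.X_iff i hi
    have hH := H.hat_iff i hi
    have hS := H.S_iff i hi
    have hl := H.last_ne i
    have ha := H.hat_adj
    simp only [pairNeighbours, hi, if_true, Multiset.coe_card, List.length_append, ← hX, ← hH]
    have hI : InnerLeft L ℓ i ↔ L i = .one ∨ (i + 1 = ℓ ∧ L i ≠ .XHat) := Iff.rfl
    rcases (show i + 1 < ℓ ∨ i + 1 = ℓ by omega) with h1 | h1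
    · have : ¬ i = 0 := by omega
      have : ¬ i + 1 = ℓ := by omega
      cases hL : L i <;> simp_all [HatLetter.base, HatLetter.isHat]
    · have : ¬ i = 0 := by omega
      have : ¬ i + 1 < ℓ := by omega
      cases hL : L i <;> simp_all [HatLetter.base, HatLetter.isHat]
  · rw [pairNeighbours, if_neg hi]
    exact Or.inl rfl

theorem range_degree (H : SingleHat L ℓ r r' h) :
    Set.range (fun v => (hatGraph (str L ℓ)).degree v) = {2, 3} := by
  refine Set.Subset.antisymm ?_ ?_
  · rintro _ ⟨v, rfl⟩
    simp only [H.degree_eq]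
    exact H.card_pairNeighbours _
  · rintro _ (rfl | rfl)
    · refine ⟨Sum.inr ⟨⟨h, H.hat_lt⟩, (H.hat_iff h H.hat_lt).2 rfl⟩, ?_⟩
      simp only [H.degree_eq]
      rw [show position L ℓ (Sum.inr _) = ℓ from rfl, pairNeighbours, if_neg (lt_irrefl ℓ)]
      rfl
    · refine ⟨Sum.inl (⟨0, (Nat.zero_le _).trans_lt H.lt_length⟩, 0), ?_⟩
      simp only [H.degree_eq]
      rw [show position L ℓ (Sum.inl _) = 0 from rfl, H.pairNeighbours_zero]
      rfl

/-- If the two pairs with letter `X` are separated after exactly `ℓ` iterations on the contracted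
multigraph, then the graph is a long-refinement graph: the pair at position `i` is split in
iteration `ℓ + 1 + i`. -/
theorem isLongRefinementGraph (H : SingleHat L ℓ r r' h)
    (hsep : ∀ t, mchi (pairNeighbours L ℓ r r' h) t r = mchi (pairNeighbours L ℓ r r' h) t r' ↔
      t < ℓ) :
    IsLongRefinementGraph (hatGraph (str L ℓ)) := by
  have := H.lt; have := H.lt_length; have := H.two_le
  have hr : r < ℓ := by omega
  set nb : HatVertex (str L ℓ) → Multiset (HatVertex (str L ℓ)) :=
    fun v => ((hatGraph (str L ℓ)).neighborFinset v).val with hnb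
  have hnbl : ∀ i j, nb (Sum.inl (i, j)) = neighbourList L ℓ r r' hr H.lt_length i j :=
    H.neighborFinset_inl
  have proj := mchi_comp nb (pairNeighbours L ℓ r r' h) (position L ℓ) ℓ fun t ht v =>
    H.map_neighborFinset v _ ((hsep t).2 ht)
  have h0 : 0 < ℓ := by omega
  -- The second wave: pair `i` is $(v_{i,1},v_{i,2})$ in zero-based positions. All pairs are unsplit
  -- up to time `ℓ` because colours come from positions; the value outside `i < ℓ` is arbitrary.
  have wave := mchi_wave nb ℓ (ℓ - 1)
    (fun i => Sum.inl (if hi : i < ℓ then ⟨i, hi⟩ else ⟨0, h0⟩, 0))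
    (fun i => Sum.inl (if hi : i < ℓ then ⟨i, hi⟩ else ⟨0, h0⟩, 1))
    (fun i _ => by rw [proj ℓ le_rfl, proj ℓ le_rfl]; rfl) ?_ ?_
  · have hlast : ∀ t, mchi nb t (Sum.inl (⟨ℓ - 1, by omega⟩, 0)) =
        mchi nb t (Sum.inl (⟨ℓ - 1, by omega⟩, 1)) ↔ t < 2 * ℓ := fun t => by
      have := wave t (ℓ - 1) le_rfl
      simp only [show ℓ - 1 < ℓ by omega, dif_pos] at this
      rw [this]; omega
    have low := le_iterationNumber_of_separated (hatGraph (str L ℓ)) (fun _ => ())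
      (a := Sum.inl (⟨ℓ - 1, by omega⟩, 0)) (b := Sum.inl (⟨ℓ - 1, by omega⟩, 1)) (T := 2 * ℓ)
      fun t => by rw [chi_eq_mchi]; exact hlast t
    have : Nonempty (HatVertex (str L ℓ)) := ⟨Sum.inl (⟨0, h0⟩, 0)⟩
    have up := iterationNumber_succ_le_card (hatGraph (str L ℓ)) (fun _ => ())
    rw [H.card_vertex] at up
    rw [IsLongRefinementGraph, H.card_vertex]
    omega
  · intro heq
    simp only [h0, dif_pos] at heq
    rw [mchi_succ_eq_iff, hnbl, hnbl, show mchi nb ℓ = mchi _ ℓ ∘ position L ℓ from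
      funext (proj ℓ le_rfl), Multiset.map_coe, Multiset.map_coe, ← List.map_map,
      ← List.map_map, H.neighbourList_zero, H.neighbourList_zero, if_pos rfl,
      if_neg one_ne_zero] at heq
    -- Equal neighbourhoods of the S-pair would, after cancelling the common position $1$, give `r`
    -- the colour of `r'` at time `ℓ`.
    have hmem : mchi (pairNeighbours L ℓ r r' h) ℓ r ∈
        [r', r'].map (mchi (pairNeighbours L ℓ r r' h) ℓ) := by
      have heq' := ((Multiset.coe_eq_coe.1 heq).cons_inv :
        ([r, r].map (mchi (pairNeighbours L ℓ r r' h) ℓ)).Perm _)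
      exact heq'.mem_iff.1 List.mem_cons_self
    have : mchi (pairNeighbours L ℓ r r' h) ℓ r = mchi (pairNeighbours L ℓ r r' h) ℓ r' := by
      simpa using hmem
    exact lt_irrefl _ ((hsep ℓ).1 this)
  · intro i hi t Heq
    have hi' : i + 1 < ℓ := by omega
    have key := map_neighbourList_succ (r := r) (r' := r') (hr := hr) (hr' := H.lt_length) hi'
      (mchi nb t) fun k hk hik => by
        have := Heq k hik (by omega)
        simpa only [hk, dif_pos] using this
    refine ⟨((neighbourList L ℓ r r' hr H.lt_length ⟨i + 1, hi'⟩ 0).map (mchi nb t)).tail, ?_, ?_⟩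
    · simp only [hi', show i < ℓ by omega, dif_pos]
      rw [hnbl, Multiset.map_coe, key]; rfl
    · simp only [hi', show i < ℓ by omega, dif_pos]
      rw [hnbl, Multiset.map_coe, key]; rfl

end SingleHat
-- Matching the one-zero families with their contractions
open HatLetter

/-- Reduces all four claims about a string to the shape of its letters and one separation time on
the contraction. -/
theorem of_singleHat {w : List HatLetter} {L : ℕ → HatLetter} {ℓ r r' h : ℕ} (hlen : w.length = ℓ)
    (hget : ∀ i (hi : i < w.length), w[i] = L i) (H : SingleHat L ℓ r r' h)
    (hsep : ∀ t, mchi (pairNeighbours L ℓ r r' h) t r = mchi (pairNeighbours L ℓ r r' h) t r' ↔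
      t < ℓ) :
    IsHatString w.get ∧ IsLongRefinementGraph (hatGraph w.get) ∧
    Odd (Fintype.card (HatVertex w.get)) ∧
    Set.range (fun v => (hatGraph w.get).degree v) = {2, 3} := by
  subst hlen
  rw [show w.get = SingleHat.str L w.length from funext fun i => hget i.1 i.2]
  exact ⟨H.isHatString, H.isLongRefinementGraph hsep, by rw [H.card_vertex]; exact ⟨_, rfl⟩,
    H.range_degree⟩

/-- The letters of a string with `0` only at `z`, `X` at `a`, `b`, and a final `1̂` at `e`. -/
def oneZeroLetter (z a b e i : ℕ) : HatLetter :=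
  if i = 0 then .S else if i = z then .zero else if i = a ∨ i = b then .X
  else if i = e then .oneHat else .one

section OneZero

variable {z a b e : ℕ}

theorem oneZeroLetter_singleHat (ha : 2 ≤ a) (hza : z < a) (hab : a < b)
    (hbe : b < e) : SingleHat (oneZeroLetter z a b e) (e + 1) a b e where
  two_le := ha
  lt := hab
  lt_length := by omega
  hat_lt := by omega
  S_iff i _ := by unfold oneZeroLetter; split_ifs <;> simp <;> omega
  X_iff i _ := by unfold oneZeroLetter; split_ifs <;> simp [HatLetter.base] <;> omega
  hat_iff i _ := by unfold oneZeroLetter; split_ifs <;> simp [HatLetter.isHat] <;> omega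
  hat_adj := Or.inr rfl
  last_ne i hi := by unfold oneZeroLetter; split_ifs <;> simp; omega

theorem pairNeighbours_zeroPair (hz : 0 < z) (hza : z < a) (hab : a < b) (hbe : b < e) :
    pairNeighbours (oneZeroLetter z a b e) (e + 1) a b e z = {z - 1, z + 1} := by
  have : ¬ InnerLeft (oneZeroLetter z a b e) (e + 1) z := by
    unfold InnerLeft oneZeroLetter; grind
  have h1 : z < e + 1 := by omega
  have h2 : z + 1 < e + 1 := by omega
  have h3 : ¬ z = e := by omega
  have h4 : ¬ (z = a ∨ z = b) := by omega
  have h5 : ¬ z = 0 := by omega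
  simp only [pairNeighbours, *, if_true, if_false]
  rfl

theorem pairNeighbours_X (hz : 0 < z) (hza : z < a) (hab : a < b) (hbe : b < e) {i : ℕ}
    (hi : i = a ∨ i = b) :
    pairNeighbours (oneZeroLetter z a b e) (e + 1) a b e i = {i - 1, i + 1, 0} := by
  have : ¬ InnerLeft (oneZeroLetter z a b e) (e + 1) i := by
    unfold InnerLeft oneZeroLetter; grind
  have h0 : 0 < i := by omega
  have h1 : i < e + 1 := by omega
  have h2 : i + 1 < e + 1 := by omega
  have h3 : ¬ i = e := by omega
  have h5 : ¬ i = 0 := by omega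
  simp only [pairNeighbours, *, if_true, if_false]
  rfl

/-- The last pair fits the uniform formula because the hat is numbered `e + 1`: it takes the place
of the successor, and the edge left over from the double edge is the loop. -/
theorem pairNeighbours_one (hab : a < b) (hbe : b < e) (i : ℕ)
    (h0 : 1 ≤ i) (h1 : i ≤ e) (hiz : i ≠ z) (hia : i ≠ a) (hib : i ≠ b) :
    pairNeighbours (oneZeroLetter z a b e) (e + 1) a b e i = {i - 1, i + 1, i} := by
  have hI : InnerLeft (oneZeroLetter z a b e) (e + 1) i := by
    unfold InnerLeft oneZeroLetter; grind
  have h1' : i < e + 1 := by omega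
  have h0' : 0 < i := h0
  have h4 : ¬ (i = a ∨ i = b) := by omega
  have h5 : ¬ i = 0 := by omega
  rcases h1.lt_or_eq with h2 | rfl
  · have h2' : i + 1 < e + 1 := by omega
    have h3 : ¬ i = e := by omega
    simp only [pairNeighbours, *, if_true, if_false]
    rfl
  · simp only [pairNeighbours, *, if_true, if_false, lt_irrefl]
    change ({i - 1, i, i + 1} : Multiset ℕ) = _
    exact congrArg _ (Multiset.pair_comm _ _)

theorem pairNeighbours_hat (L : ℕ → HatLetter) (ℓ r r' h : ℕ) :
    pairNeighbours L ℓ r r' h ℓ = {h, h} :=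
  if_neg (lt_irrefl ℓ)

end OneZero

theorem length_rep (w : List HatLetter) (k : ℕ) : (rep w k).length = k * w.length := by
  simp [rep]

theorem rep_singleton (x : HatLetter) (k : ℕ) : rep [x] k = List.replicate k x := by
  induction k with
  | zero => rfl
  | succ k ih =>
    rw [rep, List.replicate_succ, List.flatten_cons, ← rep, ih]; rfl

theorem getElem_rep (w : List HatLetter) (k i : ℕ) (hi : i < (rep w k).length)
    (hw : i % w.length < w.length) : (rep w k)[i] = w[i % w.length] := by
  induction k generalizing i with
  | zero => simp [rep] at hi
  | succ k ih =>
    have hk : rep w (k + 1) = w ++ rep w k := by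
      rw [rep, List.replicate_succ, List.flatten_cons, ← rep]
    simp only [hk]
    rw [List.getElem_append]
    split_ifs with h
    · simp only [Nat.mod_eq_of_lt h]
    · have hi' : i - w.length < (rep w k).length := by
        rw [hk, List.length_append] at hi; omega
      have hm : (i - w.length) % w.length = i % w.length := (Nat.mod_eq_sub_mod (by omega)).symm
      rw [ih _ hi' (by rw [hm]; exact hw)]
      simp only [hm]

theorem isLongRefinement_family1 (k : ℕ) {w : List HatLetter}
    (hw : w = [S] ++ rep [one] k ++ [one, zero, one] ++ rep [one] k ++ [X, one, X]
      ++ rep [one] k ++ [oneHat]) :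
    IsHatString w.get ∧ IsLongRefinementGraph (hatGraph w.get) ∧
    Odd (Fintype.card (HatVertex w.get)) ∧
    Set.range (fun v => (hatGraph w.get).degree v) = {2, 3} := by
  -- `m` is the position of the letter 0, so the string has length `3 * m + 2`.
  obtain ⟨m, hm⟩ : ∃ m, m = k + 2 := ⟨_, rfl⟩
  have h1 : 0 < m := by omega
  have h2 : 2 ≤ 2 * m := by omega
  have h3 : m < 2 * m := by omega
  have h4 : 2 * m < 2 * m + 2 := by omega
  have h5 : 2 * m + 2 < 3 * m + 1 := by omega
  have H := oneZeroLetter_singleHat h2 h3 h4 h5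
  refine of_singleHat ?_ ?_ H
    (separation_family1 m (by omega) H.pairNeighbours_zero (pairNeighbours_zeroPair h1 h3 h4 h5)
      (pairNeighbours_one h4 h5) (pairNeighbours_X h1 h3 h4 h5 (Or.inl rfl))
      (pairNeighbours_X h1 h3 h4 h5 (Or.inr rfl)) (pairNeighbours_hat _ _ _ _ _))
  · rw [hw]; simp [rep_singleton]; omega
  · subst hw
    simp only [rep_singleton]
    intro i hi
    simp only [List.getElem_append, List.length_append, List.length_replicate, List.length_cons,
      List.length_nil, List.getElem_replicate, List.getElem_cons, oneZeroLetter] at hi ⊢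
    split_ifs <;> first | rfl | omega

theorem isLongRefinement_family2 (k : ℕ) {w : List HatLetter}
    (hw : w = [S, one, one] ++ rep [one] k ++ [one, zero, one] ++ rep [one] k ++ [X, X]
      ++ rep [one] k ++ [oneHat]) :
    IsHatString w.get ∧ IsLongRefinementGraph (hatGraph w.get) ∧
    Odd (Fintype.card (HatVertex w.get)) ∧
    Set.range (fun v => (hatGraph w.get).degree v) = {2, 3} := by
  obtain ⟨m, hm⟩ : ∃ m, m = k + 2 := ⟨_, rfl⟩
  have h1 : 0 < m + 2 := by omega
  have h2 : 2 ≤ 2 * m + 2 := by omega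
  have h3 : m + 2 < 2 * m + 2 := by omega
  have h4 : 2 * m + 2 < 2 * m + 3 := by omega
  have h5 : 2 * m + 3 < 3 * m + 2 := by omega
  have H := oneZeroLetter_singleHat h2 h3 h4 h5
  refine of_singleHat ?_ ?_ H
    (separation_family2 m (by omega) H.pairNeighbours_zero (pairNeighbours_zeroPair h1 h3 h4 h5)
      (pairNeighbours_one h4 h5) (pairNeighbours_X h1 h3 h4 h5 (Or.inl rfl))
      (pairNeighbours_X h1 h3 h4 h5 (Or.inr rfl)) (pairNeighbours_hat _ _ _ _ _))
  · rw [hw]; simp [rep_singleton]; omega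
  · subst hw
    simp only [rep_singleton]
    intro i hi
    simp only [List.getElem_append, List.length_append, List.length_replicate, List.length_cons,
      List.length_nil, List.getElem_replicate, List.getElem_cons, oneZeroLetter] at hi ⊢
    split_ifs <;> first | rfl | omega

theorem isLongRefinement_family3 (k : ℕ) {w : List HatLetter}
    (hw : w = [S] ++ rep [one] k ++ [zero] ++ rep [one] k ++ [one, X, X]
      ++ rep [one] k ++ [oneHat]) :
    IsHatString w.get ∧ IsLongRefinementGraph (hatGraph w.get) ∧
    Odd (Fintype.card (HatVertex w.get)) ∧
    Set.range (fun v => (hatGraph w.get).degree v) = {2, 3} := by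
  obtain ⟨m, hm⟩ : ∃ m, m = k + 1 := ⟨_, rfl⟩
  have h1 : 0 < m := by omega
  have h2 : 2 ≤ 2 * m + 1 := by omega
  have h3 : m < 2 * m + 1 := by omega
  have h4 : 2 * m + 1 < 2 * m + 2 := by omega
  have h5 : 2 * m + 2 < 3 * m + 2 := by omega
  have H := oneZeroLetter_singleHat h2 h3 h4 h5
  refine of_singleHat ?_ ?_ H
    (separation_family3 m (by omega) H.pairNeighbours_zero (pairNeighbours_zeroPair h1 h3 h4 h5)
      (pairNeighbours_one h4 h5) (pairNeighbours_X h1 h3 h4 h5 (Or.inl rfl))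
      (pairNeighbours_X h1 h3 h4 h5 (Or.inr rfl)) (pairNeighbours_hat _ _ _ _ _))
  · rw [hw]; simp [rep_singleton]; omega
  · subst hw
    simp only [rep_singleton]
    intro i hi
    simp only [List.getElem_append, List.length_append, List.length_replicate, List.length_cons,
      List.length_nil, List.getElem_replicate, List.getElem_cons, oneZeroLetter] at hi ⊢
    split_ifs <;> first | rfl | omega

/-- The letters of `S (011)^k 00 (110)^k X1̂X (011)^k 0`, where `m = 3k + 1`. -/
def periodicLetter (m i : ℕ) : HatLetter :=
  if i = 0 then .S
  else if i = 2 * m + 1 ∨ i = 2 * m + 3 then .X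
  else if i = 2 * m + 2 then .oneHat
  else if (if i ≤ m then m - i else if i ≤ 2 * m then i - m - 1 else 3 * m + 3 - i) % 3 = 0
    then .zero else .one

/-! ### The periodic family -/

section Periodic

variable {m : ℕ}

theorem periodicLetter_singleHat (hm : 1 ≤ m) :
    SingleHat (periodicLetter m) (3 * m + 4) (2 * m + 1) (2 * m + 3) (2 * m + 2) where
  two_le := by omega
  lt := by omega
  lt_length := by omega
  hat_lt := by omega
  S_iff i _ := by unfold periodicLetter; split_ifs <;> simp <;> omega
  X_iff i _ := by unfold periodicLetter; split_ifs <;> simp [HatLetter.base] <;> omega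
  hat_iff i _ := by unfold periodicLetter; split_ifs <;> simp [HatLetter.isHat] <;> omega
  hat_adj := Or.inl (by unfold periodicLetter; split_ifs <;> first | rfl | omega)
  last_ne i hi := by
    obtain rfl : i = 3 * m + 3 := by omega
    have h1 : ¬ 3 * m + 3 ≤ m := by omega
    have h2 : ¬ 3 * m + 3 ≤ 2 * m := by omega
    simp only [periodicLetter, h1, h2, if_false, Nat.sub_self, Nat.zero_mod, if_true]
    split_ifs <;> simp

/-- Here `j` is the distance of `i` from the end of its strand at which the reflections turn, namely
`m`, `m + 1` or `3 * m + 3`. Zeros sit at distances divisible by three, so the neighbourhoods depend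
on `j` in the same way on all three strands. -/
theorem pairNeighbours_periodic {i j : ℕ} (h0 : 1 ≤ i) (h1 : i < 3 * m + 3)
    (hj : i + j = m ∨ (i = m + 1 + j ∧ j < m) ∨ (i + j = 3 * m + 3 ∧ j < m)) :
    pairNeighbours (periodicLetter m) (3 * m + 4) (2 * m + 1) (2 * m + 3) (2 * m + 2) i =
      if j % 3 = 0 then {i - 1, i + 1} else {i - 1, i + 1, i} := by
  have hL : periodicLetter m i = if j % 3 = 0 then .zero else .one := by
    unfold periodicLetter
    rw [if_neg (by omega), if_neg (by omega), if_neg (by omega),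
      show (if i ≤ m then m - i else if i ≤ 2 * m then i - m - 1 else 3 * m + 3 - i) = j by
        split_ifs <;> omega]
  have h0' : 0 < i := h0
  have h1' : i < 3 * m + 4 := by omega
  have h2 : i + 1 < 3 * m + 4 := by omega
  have h3 : ¬ i = 2 * m + 2 := by omega
  have h4 : ¬ (i = 2 * m + 1 ∨ i = 2 * m + 3) := by omega
  have h5 : ¬ i = 0 := by omega
  by_cases h : j % 3 = 0
  · have hI : ¬ InnerLeft (periodicLetter m) (3 * m + 4) i := by
      rw [InnerLeft, hL, if_pos h]; simp; omega
    simp only [pairNeighbours, hI, h0', h1', h2, h3, h4, h5, h, if_true, if_false]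
    rfl
  · have hI : InnerLeft (periodicLetter m) (3 * m + 4) i := Or.inl (by rw [hL, if_neg h])
    simp only [pairNeighbours, hI, h0', h1', h2, h3, h4, h5, h, if_true, if_false]
    rfl

theorem pairNeighbours_periodic_X {i : ℕ} (hi : i = 2 * m + 1 ∨ i = 2 * m + 3) (hm : 1 ≤ m) :
    pairNeighbours (periodicLetter m) (3 * m + 4) (2 * m + 1) (2 * m + 3) (2 * m + 2) i =
      {i - 1, i + 1, 0} := by
  have hL : periodicLetter m i = .X := by
    unfold periodicLetter; rw [if_neg (by omega), if_pos hi]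
  have hI : ¬ InnerLeft (periodicLetter m) (3 * m + 4) i := by
    rw [InnerLeft, hL]; simp; omega
  have h0' : 0 < i := by omega
  have h1' : i < 3 * m + 4 := by omega
  have h2 : i + 1 < 3 * m + 4 := by omega
  have h3 : ¬ i = 2 * m + 2 := by omega
  have h5 : ¬ i = 0 := by omega
  simp only [pairNeighbours, hI, h0', h1', h2, h3, hi, h5, if_true, if_false]
  rfl

theorem pairNeighbours_periodic_oneHat :
    pairNeighbours (periodicLetter m) (3 * m + 4) (2 * m + 1) (2 * m + 3) (2 * m + 2)
      (2 * m + 2) = {2 * m + 1, 2 * m + 3, 3 * m + 4} := by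
  have hL : periodicLetter m (2 * m + 2) = .oneHat := by
    unfold periodicLetter; rw [if_neg (by omega), if_neg (by omega), if_pos rfl]
  have hI : ¬ InnerLeft (periodicLetter m) (3 * m + 4) (2 * m + 2) := by
    rw [InnerLeft, hL]; simp; omega
  have h0' : 0 < 2 * m + 2 := by omega
  have h1' : 2 * m + 2 < 3 * m + 4 := by omega
  have h2 : 2 * m + 2 + 1 < 3 * m + 4 := by omega
  have h4 : ¬ (2 * m + 2 = 2 * m + 1 ∨ 2 * m + 2 = 2 * m + 3) := by omega
  have h5 : ¬ 2 * m + 2 = 0 := by omega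
  simp only [pairNeighbours, hI, h0', h1', h2, h4, h5, if_true, if_false]
  rfl

theorem pairNeighbours_periodic_last (hm : 1 ≤ m) :
    pairNeighbours (periodicLetter m) (3 * m + 4) (2 * m + 1) (2 * m + 3) (2 * m + 2)
      (3 * m + 3) = {3 * m + 2, 3 * m + 3} := by
  have hI : InnerLeft (periodicLetter m) (3 * m + 4) (3 * m + 3) := by
    refine Or.inr ⟨rfl, ?_⟩
    unfold periodicLetter
    split_ifs <;> simp
  have h0' : 0 < 3 * m + 3 := by omega
  have h1' : 3 * m + 3 < 3 * m + 4 := by omega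
  have h2 : ¬ 3 * m + 3 + 1 < 3 * m + 4 := by omega
  have h3 : ¬ 3 * m + 3 = 2 * m + 2 := by omega
  have h4 : ¬ (3 * m + 3 = 2 * m + 1 ∨ 3 * m + 3 = 2 * m + 3) := by omega
  have h5 : ¬ 3 * m + 3 = 0 := by omega
  simp only [pairNeighbours, hI, h0', h1', h2, h3, h4, h5, if_true, if_false]
  rfl

end Periodic

theorem getElem_rep_three (a b c : HatLetter) (k i : ℕ) (hi : i < (rep [a, b, c] k).length) :
    (rep [a, b, c] k)[i] = if i % 3 = 0 then a else if i % 3 = 1 then b else c := by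
  rw [getElem_rep _ _ _ hi (Nat.mod_lt _ (by simp))]
  simp only [List.getElem_cons, List.length_cons, List.length_nil]
  split_ifs <;> first | rfl | omega

/-- From position `n` on, the letters `L` are those of `w`. -/
def Spells (L : ℕ → HatLetter) (w : List HatLetter) (n : ℕ) : Prop :=
  ∀ i (hi : i < w.length), w[i] = L (n + i)

theorem Spells.nil {L : ℕ → HatLetter} {n : ℕ} : Spells L [] n :=
  fun _ hi => absurd hi (Nat.not_lt_zero _)

theorem Spells.cons {L : ℕ → HatLetter} {x : HatLetter} {v : List HatLetter} {n : ℕ}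
    (hv : Spells L v (n + 1)) (hx : L n = x) : Spells L (x :: v) n := fun i hi => by
  cases i with
  | zero => exact hx.symm
  | succ i =>
    rw [List.getElem_cons_succ, hv]; congr 1; omega

theorem Spells.append {L : ℕ → HatLetter} {u v : List HatLetter} {n : ℕ} (hu : Spells L u n)
    (hv : Spells L v (n + u.length)) : Spells L (u ++ v) n := fun i hi => by
  rw [List.getElem_append]
  split_ifs with h
  · exact hu i h
  · rw [hv]; congr 1; omega

theorem isLongRefinement_family4 (k : ℕ) {w : List HatLetter}
    (hw : w = [S] ++ rep [zero, one, one] k ++ [zero, zero] ++ rep [one, one, zero] k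
      ++ [X, oneHat, X] ++ rep [zero, one, one] k ++ [zero]) :
    IsHatString w.get ∧ IsLongRefinementGraph (hatGraph w.get) ∧
    Odd (Fintype.card (HatVertex w.get)) ∧
    Set.range (fun v => (hatGraph w.get).degree v) = {2, 3} := by
  obtain ⟨m, hm⟩ : ∃ m, m = 3 * k + 1 := ⟨_, rfl⟩
  have H := periodicLetter_singleHat (m := m) (by omega)
  refine of_singleHat ?_ ?_ H ?_
  · rw [hw]; simp [length_rep]; omega
  · subst hw
    intro i hi
    have h1 : ∀ n, n = 1 ∨ n = 2 * m + 4 → Spells (periodicLetter m) (rep [zero, one, one] k) n :=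
      fun n hn i hi => by
        rw [getElem_rep_three]
        simp only [length_rep, List.length_cons, List.length_nil] at hi
        unfold periodicLetter
        split_ifs <;> first | rfl | omega
    have h2 : Spells (periodicLetter m) (rep [one, one, zero] k) (m + 2) := fun i hi => by
      rw [getElem_rep_three]
      simp only [length_rep, List.length_cons, List.length_nil] at hi
      unfold periodicLetter
      split_ifs <;> first | rfl | omega
    have key : Spells (periodicLetter m) ([S] ++ rep [zero, one, one] k ++ [zero, zero] ++
        rep [one, one, zero] k ++ [X, oneHat, X] ++ rep [zero, one, one] k ++ [zero]) 0 := by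
      refine ((((((Spells.nil.cons ?_).append (h1 _ ?_)).append
        ((Spells.nil.cons ?_).cons ?_)).append ?mid).append
        (((Spells.nil.cons ?_).cons ?_).cons ?_)).append (h1 _ ?_)).append (Spells.nil.cons ?_)
      case mid =>
        convert h2 using 1
        simp only [List.length_append, length_rep, List.length_cons, List.length_nil]
        omega
      all_goals
        try simp only [List.length_append, length_rep, List.length_cons, List.length_nil]
        first
        | omega
        | exact Or.inl trivial
        | unfold periodicLetter
          split_ifs <;> first | rfl | omega
    rw [key i hi, Nat.zero_add]
  · refine separation_family4 m (by omega) H.pairNeighbours_zero ?_ ?_ ?_ ?_ ?_ ?_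
      (pairNeighbours_periodic_last (by omega))
      (pairNeighbours_periodic_X (Or.inl rfl) (by omega)) pairNeighbours_periodic_oneHat
      (pairNeighbours_periodic_X (Or.inr rfl) (by omega)) (pairNeighbours_hat _ _ _ _ _)
    · intro i j h h0 hj
      rw [pairNeighbours_periodic (j := j) h0 (by omega) (by omega), if_pos hj]
    · intro i j h h0 hj
      rw [pairNeighbours_periodic (j := j) h0 (by omega) (by omega), if_neg hj]
    · intro i j h h0 hj
      rw [pairNeighbours_periodic (j := j) (by omega) (by omega) (by omega), if_pos hj]
    · intro i j h h0 hj
      rw [pairNeighbours_periodic (j := j) (by omega) (by omega) (by omega), if_neg hj]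
    · intro i j h h0 h1 hj
      rw [pairNeighbours_periodic (j := j) (by omega) (by omega) (by omega), if_pos hj]
    · intro i j h h0 h1 hj
      rw [pairNeighbours_periodic (j := j) (by omega) (by omega) (by omega), if_neg hj]

/-! ### The sporadic strings and the conclusion -/

theorem isLongRefinement_family0 {w : List HatLetter} (hw : w = [S, oneHat, one, one, X, X]) :
    IsHatString w.get ∧ IsLongRefinementGraph (hatGraph w.get) ∧
    Odd (Fintype.card (HatVertex w.get)) ∧
    Set.range (fun v => (hatGraph w.get).degree v) = {2, 3} := by
  refine of_singleHat (ℓ := 6) (r := 4) (r' := 5) (h := 1) (by rw [hw]; rfl)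
    (L := fun i => w.getD i one) (fun i hi => (List.getD_eq_getElem _ _ hi).symm) ?_ ?_ <;> subst hw
  · exact ⟨by decide, by decide, by decide, by decide, by decide, by decide, by decide, by decide,
      fun i hi => by
        obtain rfl : i = 5 := by omega
        decide⟩
  · exact separation_family0 (by decide) (by decide) (by decide) (by decide) (by decide) (by decide) (by decide)

theorem isLongRefinement_family1_sporadic {w : List HatLetter} (hw : w = [S, zero, X, one, XHat]) :
    IsHatString w.get ∧ IsLongRefinementGraph (hatGraph w.get) ∧
    Odd (Fintype.card (HatVertex w.get)) ∧
    Set.range (fun v => (hatGraph w.get).degree v) = {2, 3} := by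
  refine of_singleHat (ℓ := 5) (r := 2) (r' := 4) (h := 4) (by rw [hw]; rfl)
    (L := fun i => w.getD i one) (fun i hi => (List.getD_eq_getElem _ _ hi).symm) ?_ ?_ <;> subst hw
  · exact ⟨by decide, by decide, by decide, by decide, by decide, by decide, by decide, by decide,
      fun i hi => by
        obtain rfl : i = 4 := by omega
        decide⟩
  · exact separation_family1_sporadic (by decide) (by decide) (by decide) (by decide) (by decide) (by decide)

theorem isLongRefinement_family2_sporadic {w : List HatLetter} (hw : w = [S, one, one, zero, X, XHat]) :
    IsHatString w.get ∧ IsLongRefinementGraph (hatGraph w.get) ∧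
    Odd (Fintype.card (HatVertex w.get)) ∧
    Set.range (fun v => (hatGraph w.get).degree v) = {2, 3} := by
  refine of_singleHat (ℓ := 6) (r := 4) (r' := 5) (h := 5) (by rw [hw]; rfl)
    (L := fun i => w.getD i one) (fun i hi => (List.getD_eq_getElem _ _ hi).symm) ?_ ?_ <;> subst hw
  · exact ⟨by decide, by decide, by decide, by decide, by decide, by decide, by decide, by decide,
      fun i hi => by
        obtain rfl : i = 5 := by omega
        decide⟩
  · exact separation_family2_sporadic (by decide) (by decide) (by decide) (by decide) (by decide) (by decide) (by decide)

end LongRefinement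

theorem mainTheorem4 (w : List LongRefinement.HatLetter)
    (hw : w ∈ LongRefinement.family0 ∪ LongRefinement.family1 ∪ LongRefinement.family2 ∪
      LongRefinement.family3 ∪ LongRefinement.family4) :
    LongRefinement.IsHatString w.get ∧
    LongRefinement.IsLongRefinementGraph (LongRefinement.hatGraph w.get) ∧
    Odd (Fintype.card (LongRefinement.HatVertex w.get)) ∧
    Set.range (fun v => (LongRefinement.hatGraph w.get).degree v) = {2, 3} := by
  rcases hw with (((hw | hw | ⟨k, hw⟩) | hw | ⟨k, hw⟩) | ⟨k, hw⟩) | ⟨k, hw⟩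
  · exact LongRefinement.isLongRefinement_family0 hw
  · exact LongRefinement.isLongRefinement_family1_sporadic hw
  · exact LongRefinement.isLongRefinement_family1 k hw
  · exact LongRefinement.isLongRefinement_family2_sporadic hw
  · exact LongRefinement.isLongRefinement_family2 k hw
  · exact LongRefinement.isLongRefinement_family3 k hw
  · exact LongRefinement.isLongRefinement_family4 k hw
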